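/- Let $V=\{A,B,C\}$ be the poset with cover relations $A\lessdot B$ and $A\lessdot C$, let $[k]$ be the chain with $k$ elements, and give $V\times[k]$ the product order. For a finite poset $P$ let $\hat P$ be $P$ with a new minimum $\hat 0$ and a new maximum $\hat 1$ adjoined, and let the order polytope $\mathcal O(P)$ be the set of order-preserving $f:\hat P\to[0,1]$ with $f(\hat 0)=0$ and $f(\hat 1)=1$. For $p\in P$ the toggle $\tau_p:\mathcal O(P)\to\mathcal O(P)$ changes only the value at $p$, which it replaces by $\min\{f(r): p\lessdot r\}+\max\{f(r): r\lessdot p\}-f(p)$ (covers taken in $\hat P$). Piecewise-linear rowmotion is $\mathrm{row}=\tau_{p_1}\circ\tau_{p_2}\circ\cdots\circ\tau_{p_m}$, where $(p_1,\dots,p_m)$ is any linear extension of $P$. Let $\mathrm{Flip}$ be the action on $\mathcal O(V\times[k])$ of the automorphism of $V\times[k]$ that exchanges $(B,i)$ and $(C,i)$ and fixes $(A,i)$ for every $i$, that is, $\mathrm{Flip}(f)$ is $f$ composed with this automorphism. (1) For every $q\ge 3$, $\mathrm{row}^q=\mathrm{Flip}$ on $\mathcal O(V\times[q-2])$. (2)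 Consequently, for every $k\ge 1$, piecewise-linear rowmotion on $\mathcal O(V\times[k])$ has order exactly $2(k+2)$ (in particular its order divides $2(k+2)$), as conjectured by Hopkins. Both hold for every choice of the linear extension used to compute $\mathrm{row}$. -/

import Mathlib

/-- The three-element poset `V` with cover relations `A ⋖ B` and `A ⋖ C`. -/
inductive VPoset : Type
  | A : VPoset
  | B : VPoset
  | C : VPoset

namespace VPoset

/-- `A` is the minimum; `B` and `C` are maximal and incomparable. -/
instance : PartialOrder VPoset where
  le x y := x = y ∨ x = A
  le_refl x := Or.inl rfl
  le_trans x y z := by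
    rintro (rfl | rfl) h
    · exact h
    · exact Or.inr rfl
  le_antisymm x y := by
    rintro (h | h) (h' | h')
    · exact h
    · exact h
    · exact h'.symm
    · exact h.trans h'.symm

instance : Finite VPoset :=
  Finite.of_surjective (fun i : Fin 3 => (![A, B, C] : Fin 3 → VPoset) i) (by
    rintro (_ | _ | _)
    · exact ⟨0, rfl⟩
    · exact ⟨1, rfl⟩
    · exact ⟨2, rfl⟩)

/-- The map exchanging `B` and `C` and fixing `A`. -/
def swap : VPoset → VPoset
  | A => A
  | B => C
  | C => B

/-- The reflection of `V`, as an automorphism of posets. -/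
def reflection : VPoset ≃o VPoset where
  toFun := swap
  invFun := swap
  left_inv := by rintro (_ | _ | _) <;> rfl
  right_inv := by rintro (_ | _ | _) <;> rfl
  map_rel_iff' := by
    rintro (_ | _ | _) (_ | _ | _) <;>
      simp [swap, LE.le]

end VPoset

/-- The poset `P` with a new minimum `0̂ = ⊥` and a new maximum `1̂ = ⊤` adjoined. -/
abbrev HatPoset (P : Type*) : Type _ := WithBot (WithTop P)

/-- The inclusion of `P` into the poset with minimum and maximum adjoined. -/
def toHat {P : Type*} (p : P) : HatPoset P := ((p : WithTop P) : WithBot (WithTop P))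

/-- The order polytope of `P`: order-preserving `f` on `P` with `0̂`, `1̂` adjoined, such that
`f 0̂ = 0` and `f 1̂ = 1` (so all values are in `[0, 1]`). -/
def OrderPolytope (P : Type*) [PartialOrder P] : Type _ :=
  {f : HatPoset P → ℝ // Monotone f ∧ f ⊥ = 0 ∧ f ⊤ = 1}

namespace OrderPolytope

variable {P : Type*} [PartialOrder P]

/-- The smallest value of `f` on the elements covering `p`. -/
noncomputable def minAbove (f : HatPoset P → ℝ) (p : P) : ℝ :=
  sInf (f '' {r | toHat p ⋖ r})

/-- The largest value of `f` on the elements covered by `p`. -/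
noncomputable def maxBelow (f : HatPoset P → ℝ) (p : P) : ℝ :=
  sSup (f '' {r | r ⋖ toHat p})

open Classical in
/-- The toggle formula: only the value at `p` changes. -/
noncomputable def toggleFun (p : P) (f : HatPoset P → ℝ) : HatPoset P → ℝ :=
  Function.update f (toHat p) (minAbove f p + maxBelow f p - f (toHat p))

theorem bot_lt_toHat (p : P) : (⊥ : HatPoset P) < toHat p := WithBot.bot_lt_coe _

theorem toHat_lt_top (p : P) : toHat p < (⊤ : HatPoset P) :=
  WithBot.coe_lt_coe.2 (WithTop.coe_lt_top p)

theorem toggleFun_self (p : P) (f : HatPoset P → ℝ) :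
    toggleFun p f (toHat p) = minAbove f p + maxBelow f p - f (toHat p) := by
  simp [toggleFun]

theorem toggleFun_of_ne (p : P) (f : HatPoset P → ℝ) {x : HatPoset P} (hx : x ≠ toHat p) :
    toggleFun p f x = f x := by
  simp [toggleFun, hx]

theorem minAbove_toggleFun (p : P) (f : HatPoset P → ℝ) :
    minAbove (toggleFun p f) p = minAbove f p := by
  unfold minAbove
  rw [Set.image_congr]
  intro r hr
  exact toggleFun_of_ne p f (ne_of_gt (CovBy.lt hr))

theorem maxBelow_toggleFun (p : P) (f : HatPoset P → ℝ) :
    maxBelow (toggleFun p f) p = maxBelow f p := by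
  unfold maxBelow
  rw [Set.image_congr]
  intro r hr
  exact toggleFun_of_ne p f (ne_of_lt (CovBy.lt hr))

theorem toggleFun_toggleFun (p : P) (f : HatPoset P → ℝ) :
    toggleFun p (toggleFun p f) = f := by
  funext x
  by_cases hx : x = toHat p
  · subst hx
    rw [toggleFun_self, minAbove_toggleFun, maxBelow_toggleFun, toggleFun_self]
    ring
  · rw [toggleFun_of_ne p _ hx, toggleFun_of_ne p _ hx]

/-- The action on the order polytope of an automorphism `e` of `P`: `(e f)(p) = f (e p)`. -/
def act (e : P ≃o P) : Equiv.Perm (OrderPolytope P) where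
  toFun f := ⟨fun x => f.1 (e.withTopCongr.withBotCongr x),
    f.2.1.comp (OrderIso.monotone _), by simpa using f.2.2.1, by simpa using f.2.2.2⟩
  invFun f := ⟨fun x => f.1 (e.withTopCongr.withBotCongr.symm x),
    f.2.1.comp (OrderIso.monotone _), by simpa using f.2.2.1, by simpa using f.2.2.2⟩
  left_inv f := Subtype.ext (funext fun x =>
    congrArg f.1 (e.withTopCongr.withBotCongr.apply_symm_apply x))
  right_inv f := Subtype.ext (funext fun x =>
    congrArg f.1 (e.withTopCongr.withBotCongr.symm_apply_apply x))

variable [Finite P]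

theorem le_minAbove {f : HatPoset P → ℝ} (hf : Monotone f) (p : P) :
    f (toHat p) ≤ minAbove f p := by
  obtain ⟨r, hr, -⟩ := exists_covBy_le_of_lt (toHat_lt_top p)
  refine le_csInf ⟨f r, r, hr, rfl⟩ ?_
  rintro _ ⟨s, hs, rfl⟩
  exact hf (CovBy.le hs)

theorem minAbove_le {f : HatPoset P → ℝ} (hf : Monotone f) (p : P) {x : HatPoset P}
    (hx : toHat p < x) : minAbove f p ≤ f x := by
  obtain ⟨r, hr, hrx⟩ := exists_covBy_le_of_lt hx
  exact (csInf_le (Set.toFinite (f '' _)).bddBelow (Set.mem_image_of_mem f hr)).trans (hf hrx)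

theorem maxBelow_le {f : HatPoset P → ℝ} (hf : Monotone f) (p : P) :
    maxBelow f p ≤ f (toHat p) := by
  obtain ⟨r, -, hr⟩ := exists_le_covBy_of_lt (bot_lt_toHat p)
  refine csSup_le ⟨f r, r, hr, rfl⟩ ?_
  rintro _ ⟨s, hs, rfl⟩
  exact hf (CovBy.le hs)

theorem le_maxBelow {f : HatPoset P → ℝ} (hf : Monotone f) (p : P) {x : HatPoset P}
    (hx : x < toHat p) : f x ≤ maxBelow f p := by
  obtain ⟨r, hxr, hr⟩ := exists_le_covBy_of_lt hx
  exact (hf hxr).trans (le_csSup (Set.toFinite (f '' _)).bddAbove (Set.mem_image_of_mem f hr))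

theorem monotone_toggleFun {f : HatPoset P → ℝ} (hf : Monotone f) (p : P) :
    Monotone (toggleFun p f) := by
  intro x y hxy
  rcases hxy.eq_or_lt with rfl | hlt
  · exact le_rfl
  by_cases hx : x = toHat p
  · subst hx
    rw [toggleFun_self, toggleFun_of_ne p f (ne_of_gt hlt)]
    have h1 := minAbove_le hf p hlt
    have h2 := maxBelow_le hf p
    linarith
  · by_cases hy : y = toHat p
    · subst hy
      rw [toggleFun_self, toggleFun_of_ne p f hx]
      have h1 := le_maxBelow hf p hlt
      have h2 := le_minAbove hf p
      linarith
    · rw [toggleFun_of_ne p f hx, toggleFun_of_ne p f hy]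
      exact hf hxy

/-- The toggle at `p`, as a self-map of the order polytope. -/
noncomputable def toggleMap (p : P) (f : OrderPolytope P) : OrderPolytope P :=
  ⟨toggleFun p f.1, monotone_toggleFun f.2.1 p,
    (toggleFun_of_ne p f.1 (ne_of_lt (bot_lt_toHat p))).trans f.2.2.1,
    (toggleFun_of_ne p f.1 (ne_of_gt (toHat_lt_top p))).trans f.2.2.2⟩

theorem toggleMap_involutive (p : P) :
    Function.Involutive (toggleMap p : OrderPolytope P → OrderPolytope P) :=
  fun f => Subtype.ext (toggleFun_toggleFun p f.1)

/-- The toggle at `p`, as a permutation of the order polytope. -/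
noncomputable def toggle (p : P) : Equiv.Perm (OrderPolytope P) :=
  (toggleMap_involutive p).toPerm

/-- Piecewise-linear rowmotion `τ_{p₁} ∘ τ_{p₂} ∘ ⋯ ∘ τ_{pₘ}` computed along the ordering
`(p₁, …, pₘ)` of `P` that is given by the bijection `L`. -/
noncomputable def rowmotion (L : P ≃ Fin (Nat.card P)) : Equiv.Perm (OrderPolytope P) :=
  (List.ofFn fun i => toggle (L.symm i)).prod

end OrderPolytope

/-- The automorphism `(v, i) ↦ (reflection v, i)` of `V × [k]`. -/
def flipIso (k : ℕ) : VPoset × Fin k ≃o VPoset × Fin k :=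
  { Equiv.prodCongr VPoset.reflection.toEquiv (Equiv.refl (Fin k)) with
    map_rel_iff' := fun {a b} =>
      and_congr (VPoset.reflection.le_iff_le (x := a.1) (y := b.1)) Iff.rfl }

/-- `Flip` on the order polytope of `V × [k]`: it exchanges the values on the `B` fiber and
on the `C` fiber. -/
def orderPolytopeFlip (k : ℕ) : Equiv.Perm (OrderPolytope (VPoset × Fin k)) :=
  OrderPolytope.act (flipIso k)

/-! Rowmotion is linearised by growth diagrams: arrays `a i j`, `b i j`, `c i j` on the strip `i ≤ j
≤ i + q`, with `q = k + 2`, whose rows are chains from `0` to `N` and whose unit squares satisfy a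
local max/min rule. For `N = 1`, complementing to `1` and reading a row backwards (the `A`-fiber
from row `i + 1`, the `B`- and `C`-fibers from row `i`) gives a point of the order polytope. The
local rule then becomes the toggle recursion, so passing to the next row is rowmotion
(`rowmotion_ladder`). A diagram is required by definition to return to itself with `b` and `c`
exchanged after `q` rows. Hence `row ^ q = Flip` as soon as every point occurs as a row of such a
diagram.

The substance is therefore an existence theorem, `IsVPath.hasGrowth`: every chain is row `0` of a
diagram with this periodicity. Diagrams are built from two elementary ones, the edge of period 2 (an
`a`-increment followed by simultaneous `b`- and `c`-increments) and the tripod of period 3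
(increments of `a`, `b`, `c` at successive sites). Three operations are available: pulling back
along a monotone map of indices (`pull`), adding two diagrams where the extrema of the local rule
are additive (`add`), and splitting a site in two (`insert`).

The induction is on the number of sites and then on the number of proper increments. Let `p` be the
site of the last proper increment of `a`. If nothing increases at `p + 1`, the chain is shortened
and the diagram is pulled back. If `b` and `c` both increase there, an edge is split off. If only
one does, say `b`, then either `c` increases at `p + 2` and a tripod is split off, or the sites `p +
1` and `p + 2` are merged and later separated by `insert`. The weight split off is the least
increment involved, so at least one increment disappears.

For the exact order, `Flip` is a nontrivial involution, and the orbit given by a single edge shows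
that the order is a multiple of `k + 2`. -/

/-! ### Growth diagrams and the interlacing of their rows -/

/-- The values `(a, b, c)` along a chain of `q` steps from `(0, 0, 0)` at `i` to `(N, N, N)` at
`i + q`, in which the `B` and `C` counts never exceed the `A` count one step earlier. -/
structure IsVPath (i q : ℤ) (N : ℝ) (a b c : ℤ → ℝ) : Prop where
  a_zero : a i = 0
  b_zero : b i = 0
  c_zero : c i = 0
  a_full : a (i + q) = N
  b_full : b (i + q) = N
  c_full : c (i + q) = N
  a_mono : ∀ j, i ≤ j → j < i + q → a j ≤ a (j + 1)
  b_mono : ∀ j, i ≤ j → j < i + q → b j ≤ b (j + 1)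
  c_mono : ∀ j, i ≤ j → j < i + q → c j ≤ c (j + 1)
  b_le : ∀ j, i ≤ j → j < i + q → b (j + 1) ≤ a j
  c_le : ∀ j, i ≤ j → j < i + q → c (j + 1) ≤ a j

namespace IsVPath

variable {i q : ℤ} {N : ℝ} {a b c : ℤ → ℝ}

theorem swap (h : IsVPath i q N a b c) : IsVPath i q N a c b :=
  ⟨h.a_zero, h.c_zero, h.b_zero, h.a_full, h.c_full, h.b_full, h.a_mono, h.c_mono, h.b_mono,
    h.c_le, h.b_le⟩

theorem a_le (h : IsVPath i q N a b c) {j k : ℤ} (hj : i ≤ j) (hjk : j ≤ k) (hk : k ≤ i + q) :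
    a j ≤ a k := by
  induction k, hjk using Int.leInduction with
  | base => exact le_rfl
  | succ k hjk ih => exact (ih (by omega)).trans (h.a_mono k (by omega) (by omega))

theorem b_le_b (h : IsVPath i q N a b c) {j k : ℤ} (hj : i ≤ j) (hjk : j ≤ k) (hk : k ≤ i + q) :
    b j ≤ b k := by
  induction k, hjk using Int.leInduction with
  | base => exact le_rfl
  | succ k hjk ih => exact (ih (by omega)).trans (h.b_mono k (by omega) (by omega))

theorem c_le_c (h : IsVPath i q N a b c) {j k : ℤ} (hj : i ≤ j) (hjk : j ≤ k) (hk : k ≤ i + q) :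
    c j ≤ c k := h.swap.b_le_b hj hjk hk

theorem a_le_top (h : IsVPath i q N a b c) {j : ℤ} (hj : i ≤ j) (hk : j ≤ i + q) : a j ≤ N :=
  h.a_full ▸ h.a_le hj hk le_rfl

theorem b_le_top (h : IsVPath i q N a b c) {j : ℤ} (hj : i ≤ j) (hk : j ≤ i + q) : b j ≤ N :=
  h.b_full ▸ h.b_le_b hj hk le_rfl

theorem c_le_top (h : IsVPath i q N a b c) {j : ℤ} (hj : i ≤ j) (hk : j ≤ i + q) : c j ≤ N :=
  h.swap.b_le_top hj hk

theorem a_nonneg (h : IsVPath i q N a b c) {j : ℤ} (hj : i ≤ j) (hk : j ≤ i + q) : 0 ≤ a j :=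
  h.a_zero ▸ h.a_le le_rfl hj hk

theorem b_nonneg (h : IsVPath i q N a b c) {j : ℤ} (hj : i ≤ j) (hk : j ≤ i + q) : 0 ≤ b j :=
  h.b_zero ▸ h.b_le_b le_rfl hj hk

theorem c_nonneg (h : IsVPath i q N a b c) {j : ℤ} (hj : i ≤ j) (hk : j ≤ i + q) : 0 ≤ c j :=
  h.swap.b_nonneg hj hk

theorem b_le_a (h : IsVPath i q N a b c) {j : ℤ} (hj : i ≤ j) (hk : j ≤ i + q) : b j ≤ a j := by
  rcases hj.eq_or_lt with rfl | hj
  · rw [h.a_zero, h.b_zero]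
  · have h1 := h.b_le (j - 1) (by omega) (by omega)
    have h2 := h.a_mono (j - 1) (by omega) (by omega)
    rw [sub_add_cancel] at h1 h2
    exact h1.trans h2

theorem c_le_a (h : IsVPath i q N a b c) {j : ℤ} (hj : i ≤ j) (hk : j ≤ i + q) : c j ≤ a j :=
  h.swap.b_le_a hj hk

end IsVPath

/-- The local rule of growth diagrams on the square with corners `(i, j)`, `(i + 1, j)`,
`(i, j + 1)` and `(i + 1, j + 1)`. -/
structure SquareRule (a b c : ℤ → ℤ → ℝ) (i j : ℤ) : Prop where
  rule_a : a i j + a (i + 1) (j + 1) =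
    a i (j + 1) + max (a (i + 1) j) (max (b i (j + 1)) (c i (j + 1)))
  rule_b : b i j + b (i + 1) (j + 1) = b (i + 1) j + min (b i (j + 1)) (a (i + 1) j)
  rule_c : c i j + c (i + 1) (j + 1) = c (i + 1) j + min (c i (j + 1)) (a (i + 1) j)

theorem SquareRule.swap {a b c : ℤ → ℤ → ℝ} {i j : ℤ} (h : SquareRule a b c i j) :
    SquareRule a c b i j :=
  ⟨by rw [h.rule_a, max_comm (b i (j + 1))], h.rule_c, h.rule_b⟩

/-- Growth diagrams with `q` steps per period: every row is a chain, consecutive rows are related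
by the local rule, and the diagram is periodic up to exchanging `b` and `c`. -/
structure IsGrowth (q : ℤ) (N : ℝ) (a b c : ℤ → ℤ → ℝ) : Prop where
  q_pos : 0 < q
  a_zero : ∀ i, a i i = 0
  b_zero : ∀ i, b i i = 0
  c_zero : ∀ i, c i i = 0
  a_full : ∀ i, a i (i + q) = N
  b_full : ∀ i, b i (i + q) = N
  c_full : ∀ i, c i (i + q) = N
  a_flip : ∀ i j, a (i + q) (j + q) = a i j
  b_flip : ∀ i j, b (i + q) (j + q) = c i j
  c_flip : ∀ i j, c (i + q) (j + q) = b i j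
  path_zero : IsVPath 0 q N (a 0) (b 0) (c 0)
  rule : ∀ i j, i < j → j < i + q → SquareRule a b c i j

theorem Int.forall_of_periodic {P : ℤ → Prop} {q : ℤ} (s : ℤ) (hq : 0 < q)
    (hP : ∀ i, P i ↔ P (i + q)) (h : ∀ i, s ≤ i → i < s + q → P i) (i : ℤ) : P i := by
  have key : ∀ k : ℤ, ∀ i, P i ↔ P (i + q * k) := by
    intro k
    induction k using Int.induction_on with
    | zero => simp
    | succ k ih => intro i; rw [ih i, hP]; ring_nf
    | pred k ih => intro i; rw [ih i, hP (i + q * (-(k : ℤ) - 1))]; ring_nf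
  have h1 := Int.emod_nonneg (i - s) hq.ne'
  have h2 := Int.emod_lt_of_pos (i - s) hq
  have h3 := h (s + (i - s) % q) (by omega) (by omega)
  rwa [key ((i - s) / q), add_assoc, Int.emod_add_mul_ediv, add_sub_cancel] at h3

theorem squareRule_add_iff {q : ℤ} {a b c : ℤ → ℤ → ℝ}
    (ha : ∀ i j, a (i + q) (j + q) = a i j) (hb : ∀ i j, b (i + q) (j + q) = c i j)
    (hc : ∀ i j, c (i + q) (j + q) = b i j) (i j : ℤ) :
    SquareRule a b c (i + q) (j + q) ↔ SquareRule a b c i j := by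
  have e1 : i + q + 1 = (i + 1) + q := by ring
  have e2 : j + q + 1 = (j + 1) + q := by ring
  constructor
  · rintro ⟨h1, h2, h3⟩
    rw [e1, e2] at h1 h2 h3
    simp only [ha, hb, hc] at h1 h2 h3
    exact ⟨by rw [h1, max_comm (c i (j + 1))], h3, h2⟩
  · rintro ⟨h1, h2, h3⟩
    refine ⟨?_, ?_, ?_⟩ <;> rw [e1, e2] <;> simp only [ha, hb, hc]
    · rw [h1, max_comm (c i (j + 1))]
    · exact h3
    · exact h2

/-- It suffices to check the local rule on one period. -/
theorem squareRule_of_window {q : ℤ} {a b c : ℤ → ℤ → ℝ} (s : ℤ) (hq : 0 < q)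
    (ha : ∀ i j, a (i + q) (j + q) = a i j) (hb : ∀ i j, b (i + q) (j + q) = c i j)
    (hc : ∀ i j, c (i + q) (j + q) = b i j)
    (h : ∀ i j, s ≤ i → i < s + q → i < j → j < i + q → SquareRule a b c i j) :
    ∀ i j, i < j → j < i + q → SquareRule a b c i j := by
  refine Int.forall_of_periodic (P := fun i => ∀ j, i < j → j < i + q → SquareRule a b c i j) s hq
    (fun i => ⟨fun H j h1 h2 => ?_, fun H j h1 h2 => ?_⟩) (fun i h1 h2 j => h i j h1 h2)
  · have := (squareRule_add_iff ha hb hc i (j - q)).2 (H (j - q) (by omega) (by omega))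
    rwa [sub_add_cancel] at this
  · exact (squareRule_add_iff ha hb hc i j).1 (H (j + q) (by omega) (by omega))

namespace IsVPath

variable {q : ℤ} {N : ℝ} {a b c : ℤ → ℤ → ℝ} {i : ℤ}

/-- Interlacing of consecutive rows. The maximum in `rule_a` is at least `b i (j + 1)`, and it is at
most `a i j` by the chain conditions of row `i` and the bound already known at `j`. The minimum in
`rule_b` is at most `b i (j + 1)`. With monotonicity of `a i`, the three bounds pass from `j` to `j
+ 1`. -/
theorem step_aux (h : IsVPath i q N (a i) (b i) (c i)) (ha0 : a (i + 1) (i + 1) = 0)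
    (hb0 : b (i + 1) (i + 1) = 0)
    (rule : ∀ j, i < j → j < i + q → SquareRule a b c i j) {j : ℤ} (hij : i + 1 ≤ j)
    (hj : j ≤ i + q) :
    b i j ≤ a (i + 1) j ∧ a (i + 1) j ≤ a i j ∧ b (i + 1) j ≤ b i j := by
  induction j, hij using Int.leInduction with
  | base =>
    have h1 := h.b_le i le_rfl (by omega)
    have h2 := h.a_nonneg (j := i + 1) (by omega) hj
    have h3 := h.b_nonneg (j := i + 1) (by omega) hj
    rw [h.a_zero] at h1
    rw [ha0, hb0]
    exact ⟨h1, h2, h3⟩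
  | succ j hij ih =>
    obtain ⟨h1, h2, h3⟩ := ih (by omega)
    have r := rule j (by omega) (by omega)
    have ra := r.rule_a
    have rb := r.rule_b
    have m := h.a_mono j (by omega) (by omega)
    have lb := h.b_le j (by omega) (by omega)
    have lc := h.c_le j (by omega) (by omega)
    have e1 : b i (j + 1) ≤ max (a (i + 1) j) (max (b i (j + 1)) (c i (j + 1))) :=
      (le_max_left _ _).trans (le_max_right _ _)
    have e2 : max (a (i + 1) j) (max (b i (j + 1)) (c i (j + 1))) ≤ a i j :=
      max_le h2 (max_le lb lc)
    have e3 := min_le_left (b i (j + 1)) (a (i + 1) j)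
    exact ⟨by linarith, by linarith, by linarith⟩

/-- The local rule carries the chain conditions to the next row, which is why `IsGrowth` imposes
them on row `0` only. The last step of row `i + 1`, from `i + q` to `i + q + 1`, lies outside the
squares covered by the rule; there the boundary value `N` is used. -/
theorem step (h : IsVPath i q N (a i) (b i) (c i)) (ha0 : a (i + 1) (i + 1) = 0)
    (hb0 : b (i + 1) (i + 1) = 0) (hc0 : c (i + 1) (i + 1) = 0)
    (haN : a (i + 1) (i + 1 + q) = N) (hbN : b (i + 1) (i + 1 + q) = N)
    (hcN : c (i + 1) (i + 1 + q) = N)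
    (rule : ∀ j, i < j → j < i + q → SquareRule a b c i j) :
    IsVPath (i + 1) q N (a (i + 1)) (b (i + 1)) (c (i + 1)) := by
  have A := fun {j : ℤ} => h.step_aux (j := j) ha0 hb0 rule
  have A' := fun {j : ℤ} => h.swap.step_aux (j := j) ha0 hc0 (fun j h1 h2 => (rule j h1 h2).swap)
  have last : ∀ j, j < i + 1 + q → i + 1 ≤ j → j < i + q ∨ j = i + q := fun j _ _ => by omega
  have eN : i + q + 1 = i + 1 + q := by ring
  refine ⟨ha0, hb0, hc0, haN, hbN, hcN, fun j h1 h2 => ?_, fun j h1 h2 => ?_, fun j h1 h2 => ?_,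
    fun j h1 h2 => ?_, fun j h1 h2 => ?_⟩ <;> rcases last j h2 h1 with h3 | rfl
  · have r := (rule j (by omega) h3).rule_a
    have m := h.a_mono j (by omega) (by omega)
    have := le_max_left (a (i + 1) j) (max (b i (j + 1)) (c i (j + 1)))
    linarith
  · rw [eN, haN]
    exact (A h1 le_rfl).2.1.trans_eq h.a_full
  · have r := (rule j (by omega) h3).rule_b
    have m := h.b_mono j (by omega) (by omega)
    have := le_min m (A h1 h3.le).1
    linarith
  · rw [eN, hbN]
    exact (A h1 le_rfl).2.2.trans_eq h.b_full
  · have r := (rule j (by omega) h3).rule_c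
    have m := h.c_mono j (by omega) (by omega)
    have := le_min m (A' h1 h3.le).1
    linarith
  · rw [eN, hcN]
    exact (A' h1 le_rfl).2.2.trans_eq h.c_full
  · have r := (rule j (by omega) h3).rule_b
    have := min_le_right (b i (j + 1)) (a (i + 1) j)
    have := (A h1 h3.le).2.2
    linarith
  · rw [eN, hbN]
    exact h.b_full.symm.trans_le (A h1 le_rfl).1
  · have r := (rule j (by omega) h3).rule_c
    have := min_le_right (c i (j + 1)) (a (i + 1) j)
    have := (A' h1 h3.le).2.2
    linarith
  · rw [eN, hcN]
    exact h.c_full.symm.trans_le (A' h1 le_rfl).1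

end IsVPath

namespace IsGrowth

variable {q : ℤ} {N : ℝ} {a b c : ℤ → ℤ → ℝ}

theorem swap (h : IsGrowth q N a b c) : IsGrowth q N a c b :=
  ⟨h.q_pos, h.a_zero, h.c_zero, h.b_zero, h.a_full, h.c_full, h.b_full, h.a_flip, h.c_flip,
    h.b_flip, h.path_zero.swap, fun i j h1 h2 => (h.rule i j h1 h2).swap⟩

theorem path_flip (h : IsGrowth q N a b c) {i : ℤ} (hp : IsVPath (i + q) q N (a (i + q)) (b (i + q))
    (c (i + q))) : IsVPath i q N (a i) (b i) (c i) := by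
  have e : ∀ j : ℤ, j + 1 + q = j + q + 1 := fun j => by ring
  refine ⟨h.a_zero i, h.b_zero i, h.c_zero i, h.a_full i, h.b_full i, h.c_full i, ?_, ?_, ?_, ?_, ?_⟩
    <;> intro j h1 h2
  · rw [← h.a_flip i j, ← h.a_flip i (j + 1), e]; exact hp.a_mono _ (by omega) (by omega)
  · rw [← h.c_flip i j, ← h.c_flip i (j + 1), e]; exact hp.c_mono _ (by omega) (by omega)
  · rw [← h.b_flip i j, ← h.b_flip i (j + 1), e]; exact hp.b_mono _ (by omega) (by omega)
  · rw [← h.a_flip i j, ← h.c_flip i (j + 1), e]; exact hp.c_le _ (by omega) (by omega)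
  · rw [← h.a_flip i j, ← h.b_flip i (j + 1), e]; exact hp.b_le _ (by omega) (by omega)

theorem path (h : IsGrowth q N a b c) (i : ℤ) : IsVPath i q N (a i) (b i) (c i) := by
  have nonneg : ∀ i : ℤ, 0 ≤ i → IsVPath i q N (a i) (b i) (c i) := by
    intro i hi
    induction i, hi using Int.leInduction with
    | base => exact h.path_zero
    | succ i hi ih =>
      exact ih.step (h.a_zero _) (h.b_zero _) (h.c_zero _) (h.a_full _) (h.b_full _)
        (h.c_full _) (h.rule i)
  have key : ∀ k : ℕ, ∀ i : ℤ, 0 ≤ i + q * k → IsVPath i q N (a i) (b i) (c i) := by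
    intro k
    induction k with
    | zero => intro i hi; exact nonneg i (by simpa using hi)
    | succ k ih =>
      intro i hi
      refine h.path_flip (ih (i + q) ?_)
      push_cast at hi
      linarith
  -- Since `q ≥ 1`, shifting by `|i|` periods brings every row to a nonnegative index.
  refine key i.natAbs i ?_
  have := h.q_pos
  have h1 : (0 : ℤ) ≤ i.natAbs := by positivity
  have h2 : -(i.natAbs : ℤ) ≤ i := by omega
  nlinarith

theorem b_le_a_succ (h : IsGrowth q N a b c) {i j : ℤ} (hij : i + 1 ≤ j) (hj : j ≤ i + q) :
    b i j ≤ a (i + 1) j :=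
  ((h.path i).step_aux (h.a_zero _) (h.b_zero _) (h.rule i) hij hj).1

theorem c_le_a_succ (h : IsGrowth q N a b c) {i j : ℤ} (hij : i + 1 ≤ j) (hj : j ≤ i + q) :
    c i j ≤ a (i + 1) j := h.swap.b_le_a_succ hij hj

theorem a_succ_le_a (h : IsGrowth q N a b c) {i j : ℤ} (hij : i + 1 ≤ j) (hj : j ≤ i + q) :
    a (i + 1) j ≤ a i j :=
  ((h.path i).step_aux (h.a_zero _) (h.b_zero _) (h.rule i) hij hj).2.1

theorem b_succ (h : IsGrowth q N a b c) (i : ℤ) : b i (i + 1) = 0 := by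
  have h0 := h.q_pos
  have h1 := (h.path i).b_le i le_rfl (by omega)
  have h2 := (h.path i).b_nonneg (j := i + 1) (by omega) (by omega)
  rw [h.a_zero] at h1
  exact le_antisymm h1 h2

theorem c_succ (h : IsGrowth q N a b c) (i : ℤ) : c i (i + 1) = 0 := h.swap.b_succ i

end IsGrowth

/-! ### Operations on growth diagrams: pullback, periodic extension, sum -/

/-- The number of times the `q`-periodic site `s` has been passed at `i`, counted from `s`. -/
def siteCount (q s i : ℤ) : ℤ := (i + q - s) / q

theorem siteCount_add {q : ℤ} (hq : 0 < q) (s i : ℤ) :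
    siteCount q s (i + q) = siteCount q s i + 1 := by
  unfold siteCount
  rw [show i + q + q - s = i + q - s + q by ring, Int.add_ediv_of_dvd_right (dvd_refl q),
    Int.ediv_self hq.ne']

/-- The windows needed when rows stay within one period and columns reach at most one period
further. In this form `omega` can evaluate all index maps built from `siteCount`. -/
theorem siteCount_spec {q : ℤ} (hq : 0 < q) (s i : ℤ) :
    (s - q ≤ i → i < s → siteCount q s i = 0) ∧ (s ≤ i → i < s + q → siteCount q s i = 1) ∧
      (s + q ≤ i → i < s + q + q → siteCount q s i = 2) := by
  unfold siteCount
  refine ⟨fun h1 h2 => ?_, fun h1 h2 => ?_, fun h1 h2 => ?_⟩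
  · exact Int.ediv_eq_zero_of_lt (by omega) (by omega)
  · rw [Int.ediv_eq_iff_of_pos hq]; constructor <;> linarith
  · rw [Int.ediv_eq_iff_of_pos hq]; constructor <;> linarith

namespace IsGrowth

variable {q n : ℤ} {N : ℝ} {a b c : ℤ → ℤ → ℝ}

/-- Pulling back a growth diagram along a periodic map with steps `0` and `1`. -/
theorem pull (h : IsGrowth n N a b c) (hq : 0 < q) {ι : ℤ → ℤ} (hι : ∀ i, ι (i + q) = ι i + n)
    (s : ℤ) (step : ∀ i, s ≤ i → i < s + q → ι (i + 1) = ι i ∨ ι (i + 1) = ι i + 1) :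
    IsGrowth q N (fun i j => a (ι i) (ι j)) (fun i j => b (ι i) (ι j))
      (fun i j => c (ι i) (ι j)) := by
  have step : ∀ i, ι (i + 1) = ι i ∨ ι (i + 1) = ι i + 1 := by
    refine Int.forall_of_periodic s hq (fun i => ?_) step
    rw [show i + q + 1 = i + 1 + q by ring, hι, hι]
    omega
  have mono : ∀ {i j : ℤ}, i ≤ j → ι i ≤ ι j := by
    intro i j hij
    induction j, hij using Int.leInduction with
    | base => exact le_rfl
    | succ j hij ih => have := step j; omega
  have p0 := h.path (ι 0)
  have bd : ∀ {i j : ℤ}, i ≤ j → j ≤ i + q → ι i ≤ ι j ∧ ι j ≤ ι i + n := by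
    intro i j h1 h2
    have := mono h1
    have := mono h2
    rw [hι] at this
    omega
  have ba : ∀ {i j : ℤ}, i ≤ j → j < i + q → b (ι i) (ι (j + 1)) ≤ a (ι i) (ι j) := by
    intro i j h1 h2
    have e1 := bd h1 h2.le
    have e2 := bd (i := i) (j := j + 1) (by omega) (by omega)
    rcases step j with e | e <;> rw [e] at e2 ⊢
    · exact (h.path (ι i)).b_le_a e1.1 e1.2
    · exact (h.path (ι i)).b_le _ e1.1 (by omega)
  have ca : ∀ {i j : ℤ}, i ≤ j → j < i + q → c (ι i) (ι (j + 1)) ≤ a (ι i) (ι j) := by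
    intro i j h1 h2
    have e1 := bd h1 h2.le
    have e2 := bd (i := i) (j := j + 1) (by omega) (by omega)
    rcases step j with e | e <;> rw [e] at e2 ⊢
    · exact (h.path (ι i)).c_le_a e1.1 e1.2
    · exact (h.path (ι i)).c_le _ e1.1 (by omega)
  refine ⟨hq, fun i => h.a_zero _, fun i => h.b_zero _, fun i => h.c_zero _, fun i => ?_,
    fun i => ?_, fun i => ?_, fun i j => ?_, fun i j => ?_, fun i j => ?_, ?_, fun i j h1 h2 => ?_⟩
  · rw [hι, h.a_full]
  · rw [hι, h.b_full]
  · rw [hι, h.c_full]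
  · rw [hι, hι, h.a_flip]
  · rw [hι, hι, h.b_flip]
  · rw [hι, hι, h.c_flip]
  · refine ⟨h.a_zero _, h.b_zero _, h.c_zero _, ?_, ?_, ?_, ?_, ?_, ?_, ?_, ?_⟩
    · rw [hι, h.a_full]
    · rw [hι, h.b_full]
    · rw [hι, h.c_full]
    · intro j h1 h2
      exact p0.a_le (bd h1 h2.le).1 (mono (by omega)) (bd (by omega) (by omega)).2
    · intro j h1 h2
      exact p0.b_le_b (bd h1 h2.le).1 (mono (by omega)) (bd (by omega) (by omega)).2
    · intro j h1 h2
      exact p0.c_le_c (bd h1 h2.le).1 (mono (by omega)) (bd (by omega) (by omega)).2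
    · intro j h1 h2
      exact ba h1 h2
    · intro j h1 h2
      exact ca h1 h2
  · have B := ba h1.le h2
    have C := ca h1.le h2
    have m1 : ι (i + 1) ≤ ι j := mono (by omega)
    have m2 := bd (i := i) (j := j + 1) (by omega) (by omega)
    -- If `ι` stands still in either direction the square collapses, and interlacing decides every
    -- maximum and minimum. Otherwise it is a genuine square of the given diagram.
    rcases step i with e1 | e1
    · refine ⟨?_, ?_, ?_⟩ <;> simp only [e1]
      · rw [max_eq_left (max_le B C), add_comm]
      · rw [min_eq_left B]
      · rw [min_eq_left C]
    rw [e1] at m1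
    rcases step j with e2 | e2 <;> rw [e2] at m2
    · have B' := h.b_le_a_succ m1 m2.2
      have C' := h.c_le_a_succ m1 m2.2
      refine ⟨?_, ?_, ?_⟩ <;> simp only [e1, e2]
      · rw [max_eq_left (max_le B' C')]
      · rw [min_eq_left B', add_comm]
      · rw [min_eq_left C', add_comm]
    · have r := h.rule (ι i) (ι j) (by omega) (by omega)
      refine ⟨?_, ?_, ?_⟩ <;> simp only [e1, e2]
      · exact r.rule_a
      · exact r.rule_b
      · exact r.rule_c

/-- Extending a diagram from one period of rows. -/
theorem exists_of_window {u v w : ℤ → ℤ → ℝ} (hq : 0 < q) {R : ℤ} (hR0 : R ≤ 0) (hR1 : 0 < R + q)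
    (u_zero : ∀ i, R ≤ i → i < R + q → u i i = 0) (v_zero : ∀ i, R ≤ i → i < R + q → v i i = 0)
    (w_zero : ∀ i, R ≤ i → i < R + q → w i i = 0)
    (u_full : ∀ i, R ≤ i → i < R + q → u i (i + q) = N)
    (v_full : ∀ i, R ≤ i → i < R + q → v i (i + q) = N)
    (w_full : ∀ i, R ≤ i → i < R + q → w i (i + q) = N)
    (u_flip : ∀ j, u (R + q) (j + q) = u R j) (v_flip : ∀ j, v (R + q) (j + q) = w R j)
    (w_flip : ∀ j, w (R + q) (j + q) = v R j) (path_zero : IsVPath 0 q N (u 0) (v 0) (w 0))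
    (rule : ∀ i j, R ≤ i → i < R + q → i < j → j < i + q → SquareRule u v w i j) :
    ∃ a b c, IsGrowth q N a b c ∧ a 0 = u 0 ∧ b 0 = v 0 ∧ c 0 = w 0 := by
  -- `k i` numbers the window containing row `i`, with `0` for the given rows. Odd windows carry `v`
  -- and `w` exchanged.
  let k : ℤ → ℤ := siteCount q (R + q)
  have hk : ∀ i, k (i + q) = k i + 1 := siteCount_add hq _
  have k0 : ∀ i, R ≤ i → i < R + q → k i = 0 := fun i h1 h2 =>
    (siteCount_spec hq (R + q) i).1 (by omega) (by omega)
  have k1 : k (R + q) = 1 := (siteCount_spec hq (R + q) (R + q)).2.1 (by omega) (by omega)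
  let a : ℤ → ℤ → ℝ := fun i j => u (i - q * k i) (j - q * k i)
  let b : ℤ → ℤ → ℝ := fun i j =>
    if Even (k i) then v (i - q * k i) (j - q * k i) else w (i - q * k i) (j - q * k i)
  let c : ℤ → ℤ → ℝ := fun i j =>
    if Even (k i) then w (i - q * k i) (j - q * k i) else v (i - q * k i) (j - q * k i)
  have es : ∀ i j, j + q - q * (k i + 1) = j - q * k i := fun i j => by ring
  have a_flip : ∀ i j, a (i + q) (j + q) = a i j := fun i j => by simp only [a, hk, es]
  have b_flip : ∀ i j, b (i + q) (j + q) = c i j := fun i j => by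
    by_cases hki : Even (k i) <;> simp [b, c, hk, es, hki]
  have c_flip : ∀ i j, c (i + q) (j + q) = b i j := fun i j => by
    by_cases hki : Even (k i) <;> simp [b, c, hk, es, hki]
  -- Row `R + q`, the first of the next window, is included: the squares on the last row of the
  -- window reach it. This is where the flip hypotheses enter.
  have a_eq : ∀ i j, R ≤ i → i ≤ R + q → a i j = u i j := fun i j h1 h2 => by
    rcases h2.lt_or_eq with h2 | rfl
    · simp [a, k0 i h1 h2]
    · simp only [a, k1, mul_one, add_sub_cancel_right]
      rw [← u_flip, sub_add_cancel]
  have b_eq : ∀ i j, R ≤ i → i ≤ R + q → b i j = v i j := fun i j h1 h2 => by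
    rcases h2.lt_or_eq with h2 | rfl
    · simp [b, k0 i h1 h2]
    · simp only [b, k1, mul_one, add_sub_cancel_right, Int.not_even_one, if_false]
      rw [← v_flip, sub_add_cancel]
  have c_eq : ∀ i j, R ≤ i → i ≤ R + q → c i j = w i j := fun i j h1 h2 => by
    rcases h2.lt_or_eq with h2 | rfl
    · simp [c, k0 i h1 h2]
    · simp only [c, k1, mul_one, add_sub_cancel_right, Int.not_even_one, if_false]
      rw [← w_flip, sub_add_cancel]
  have ea : a 0 = u 0 := funext fun j => a_eq 0 j hR0 hR1.le
  have eb : b 0 = v 0 := funext fun j => b_eq 0 j hR0 hR1.le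
  have ec : c 0 = w 0 := funext fun j => c_eq 0 j hR0 hR1.le
  have bc_zero : ∀ i, b i i = 0 ∧ c i i = 0 := Int.forall_of_periodic R hq
    (fun i => by rw [b_flip, c_flip, and_comm]) fun i h1 h2 => by
      rw [b_eq i i h1 h2.le, c_eq i i h1 h2.le]
      exact ⟨v_zero i h1 h2, w_zero i h1 h2⟩
  have bc_full : ∀ i, b i (i + q) = N ∧ c i (i + q) = N := Int.forall_of_periodic R hq
    (fun i => by rw [b_flip, c_flip, and_comm]) fun i h1 h2 => by
      rw [b_eq i _ h1 h2.le, c_eq i _ h1 h2.le]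
      exact ⟨v_full i h1 h2, w_full i h1 h2⟩
  refine ⟨a, b, c, ⟨hq, ?_, fun i => (bc_zero i).1, fun i => (bc_zero i).2, ?_,
    fun i => (bc_full i).1, fun i => (bc_full i).2, a_flip, b_flip, c_flip, ?_, ?_⟩, ea, eb, ec⟩
  · exact Int.forall_of_periodic R hq (fun i => by rw [a_flip]) fun i h1 h2 => by
      rw [a_eq i i h1 h2.le, u_zero i h1 h2]
  · exact Int.forall_of_periodic R hq (fun i => by rw [a_flip]) fun i h1 h2 => by
      rw [a_eq i _ h1 h2.le, u_full i h1 h2]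
  · rw [ea, eb, ec]
    exact path_zero
  · refine squareRule_of_window R hq a_flip b_flip c_flip fun i j h1 h2 h3 h4 => ?_
    obtain ⟨ra, rb, rc⟩ := rule i j h1 h2 h3 h4
    constructor <;> simp only [a_eq i _ h1 h2.le, a_eq (i + 1) _ (by omega) (by omega),
      b_eq i _ h1 h2.le, b_eq (i + 1) _ (by omega) (by omega), c_eq i _ h1 h2.le,
      c_eq (i + 1) _ (by omega) (by omega)] <;> assumption

/-- The sum of two growth diagrams is one if on each square the extrema of the local rule are
additive. -/
theorem add {M : ℝ} {a' b' c' : ℤ → ℤ → ℝ} (h : IsGrowth q N a b c) (h' : IsGrowth q M a' b' c')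
    (R : ℤ) (compat : ∀ i j, R ≤ i → i < R + q → i < j → j < i + q →
      (a' (i + 1) j = b' i (j + 1) ∧ a' (i + 1) j = c' i (j + 1)) ∨
      (max (a (i + 1) j + a' (i + 1) j) (max (b i (j + 1) + b' i (j + 1))
          (c i (j + 1) + c' i (j + 1))) =
        max (a (i + 1) j) (max (b i (j + 1)) (c i (j + 1))) +
          max (a' (i + 1) j) (max (b' i (j + 1)) (c' i (j + 1))) ∧
        min (b i (j + 1) + b' i (j + 1)) (a (i + 1) j + a' (i + 1) j) =
          min (b i (j + 1)) (a (i + 1) j) + min (b' i (j + 1)) (a' (i + 1) j) ∧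
        min (c i (j + 1) + c' i (j + 1)) (a (i + 1) j + a' (i + 1) j) =
          min (c i (j + 1)) (a (i + 1) j) + min (c' i (j + 1)) (a' (i + 1) j))) :
    IsGrowth q (N + M) (fun i j => a i j + a' i j) (fun i j => b i j + b' i j)
      (fun i j => c i j + c' i j) := by
  have a_flip : ∀ i j, a (i + q) (j + q) + a' (i + q) (j + q) = a i j + a' i j := fun i j => by
    rw [h.a_flip, h'.a_flip]
  have b_flip : ∀ i j, b (i + q) (j + q) + b' (i + q) (j + q) = c i j + c' i j := fun i j => by
    rw [h.b_flip, h'.b_flip]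
  have c_flip : ∀ i j, c (i + q) (j + q) + c' (i + q) (j + q) = b i j + b' i j := fun i j => by
    rw [h.c_flip, h'.c_flip]
  refine ⟨h.q_pos, fun i => ?_, fun i => ?_, fun i => ?_, fun i => ?_, fun i => ?_, fun i => ?_,
    a_flip, b_flip, c_flip, ?_, ?_⟩
  · rw [h.a_zero, h'.a_zero, add_zero]
  · rw [h.b_zero, h'.b_zero, add_zero]
  · rw [h.c_zero, h'.c_zero, add_zero]
  · rw [h.a_full, h'.a_full]
  · rw [h.b_full, h'.b_full]
  · rw [h.c_full, h'.c_full]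
  · have p := h.path_zero
    have p' := h'.path_zero
    refine ⟨?_, ?_, ?_, ?_, ?_, ?_, ?_, ?_, ?_, ?_, ?_⟩
    · rw [p.a_zero, p'.a_zero, add_zero]
    · rw [p.b_zero, p'.b_zero, add_zero]
    · rw [p.c_zero, p'.c_zero, add_zero]
    · rw [p.a_full, p'.a_full]
    · rw [p.b_full, p'.b_full]
    · rw [p.c_full, p'.c_full]
    · exact fun j h1 h2 => add_le_add (p.a_mono j h1 h2) (p'.a_mono j h1 h2)
    · exact fun j h1 h2 => add_le_add (p.b_mono j h1 h2) (p'.b_mono j h1 h2)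
    · exact fun j h1 h2 => add_le_add (p.c_mono j h1 h2) (p'.c_mono j h1 h2)
    · exact fun j h1 h2 => add_le_add (p.b_le j h1 h2) (p'.b_le j h1 h2)
    · exact fun j h1 h2 => add_le_add (p.c_le j h1 h2) (p'.c_le j h1 h2)
  · refine squareRule_of_window R h.q_pos a_flip b_flip c_flip fun i j h1 h2 h3 h4 => ?_
    have r := h.rule i j h3 h4
    have r' := h'.rule i j h3 h4
    have ra := r.rule_a
    have rb := r.rule_b
    have rc := r.rule_c
    have ra' := r'.rule_a
    have rb' := r'.rule_b
    have rc' := r'.rule_c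
    -- In the first alternative the second diagram shifts all arguments of the extrema by the same
    -- amount.
    rcases compat i j h1 h2 h3 h4 with ⟨e1, e2⟩ | ⟨e1, e2, e3⟩
    · rw [← e1, ← e2, max_self, max_self] at ra'
      rw [← e1, min_self] at rb'
      rw [← e2, min_self] at rc'
      refine ⟨?_, ?_, ?_⟩
      · rw [← e1, ← e2, max_add_add_right, max_add_add_right]; linarith
      · rw [← e1, min_add_add_right]; linarith
      · rw [← e2, min_add_add_right]; linarith
    · refine ⟨?_, ?_, ?_⟩
      · rw [e1]; linarith
      · rw [e2]; linarith
      · rw [e3]; linarith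

end IsGrowth

/-! ### Edges and tripods, and adding them to a diagram -/

/-- The number of passages through the three consecutive sites `p`, `p + 1` and `p + 2`. -/
def tripodCount (q p i : ℤ) : ℤ := siteCount q p i + siteCount q (p + 1) i + siteCount q (p + 2) i

theorem tripodCount_spec {q p : ℤ} (hp : 1 ≤ p) (hpq : p + 2 ≤ q) (i : ℤ) :
    (p + 2 - q ≤ i → i < p → tripodCount q p i = 0) ∧ (i = p → tripodCount q p i = 1) ∧
      (i = p + 1 → tripodCount q p i = 2) ∧
      (p + 2 ≤ i → i < p + q → tripodCount q p i = 3) ∧ (i = p + q → tripodCount q p i = 4) ∧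
      (i = p + q + 1 → tripodCount q p i = 5) ∧
      (p + 2 + q ≤ i → i < p + q + q → tripodCount q p i = 6) := by
  have s1 := siteCount_spec (q := q) (by omega) p i
  have s2 := siteCount_spec (q := q) (by omega) (p + 1) i
  have s3 := siteCount_spec (q := q) (by omega) (p + 2) i
  simp only [tripodCount]
  omega

/-- The five kinds of squares on which the pulled back tripod is not constant. -/
theorem tripodCount_square {q p : ℤ} (hp : 1 ≤ p) (hpq : p + 2 ≤ q) {i j : ℤ} (h1 : p + 2 - q ≤ i)
    (h2 : i < p + 2) (h3 : i < j) (h4 : j < i + q) {x x' y y' : ℤ} (hx : x = tripodCount q p i)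
    (hx' : x' = tripodCount q p (i + 1)) (hy : y = tripodCount q p j)
    (hy' : y' = tripodCount q p (j + 1)) :
    (i ≤ p - 2 ∧ j = p ∧ x = 0 ∧ x' = 0 ∧ y = 1 ∧ y' = 2) ∨
    (i = p - 1 ∧ j = p ∧ x = 0 ∧ x' = 1 ∧ y = 1 ∧ y' = 2) ∨
    (i = p ∧ j = p + 1 ∧ x = 1 ∧ x' = 2 ∧ y = 2 ∧ y' = 3) ∨
    (i = p ∧ (p + 2 ≤ j ∧ j ≤ p + q - 2) ∧ x = 1 ∧ x' = 2 ∧ y = 3 ∧ y' = 3) ∨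
    (i = p + 1 ∧ j = p + q - 1 ∧ x = 2 ∧ x' = 3 ∧ y = 3 ∧ y' = 4) ∨
    ((x + 3 ≤ y' ∨ x + 2 = y' ∧ x % 2 = 0) ↔ x' < y) ∧
      ((x + 3 ≤ y' ∨ x + 2 = y' ∧ x % 2 = 1) ↔ x' < y) := by
  have t0 : ∀ k, p + 2 - q ≤ k → k < p → tripodCount q p k = 0 := fun k =>
    (tripodCount_spec hp hpq k).1
  have t3 : ∀ k, p + 2 ≤ k → k < p + q → tripodCount q p k = 3 := fun k =>
    (tripodCount_spec hp hpq k).2.2.2.1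
  have t1 : ∀ k, k = p → tripodCount q p k = 1 := fun k => (tripodCount_spec hp hpq k).2.1
  have t2 : ∀ k, k = p + 1 → tripodCount q p k = 2 := fun k => (tripodCount_spec hp hpq k).2.2.1
  have t4 : ∀ k, k = p + q → tripodCount q p k = 4 := fun k =>
    (tripodCount_spec hp hpq k).2.2.2.2.1
  have t5 : ∀ k, k = p + q + 1 → tripodCount q p k = 5 := fun k =>
    (tripodCount_spec hp hpq k).2.2.2.2.2.1
  have iv : (x = 0 ∧ x' = 0 ∧ i ≤ p - 2) ∨ (x = 0 ∧ x' = 1 ∧ i = p - 1) ∨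
      (x = 1 ∧ x' = 2 ∧ i = p) ∨ (x = 2 ∧ x' = 3 ∧ i = p + 1) := by
    rcases (by omega : i ≤ p - 2 ∨ i = p - 1 ∨ i = p ∨ i = p + 1) with h | h | h | h
    · exact .inl ⟨hx.trans (t0 _ (by omega) (by omega)), hx'.trans (t0 _ (by omega) (by omega)), h⟩
    · exact .inr (.inl ⟨hx.trans (t0 _ (by omega) (by omega)), hx'.trans (t1 _ (by omega)), h⟩)
    · exact .inr (.inr (.inl ⟨hx.trans (t1 _ h), hx'.trans (t2 _ (by omega)), h⟩))
    · exact .inr (.inr (.inr ⟨hx.trans (t2 _ h), hx'.trans (t3 _ (by omega) (by omega)), h⟩))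
  have jv : (y = 0 ∧ y' = 0 ∧ j ≤ p - 2) ∨ (y = 0 ∧ y' = 1 ∧ j = p - 1) ∨
      (y = 1 ∧ y' = 2 ∧ j = p) ∨ (y = 2 ∧ y' = 3 ∧ j = p + 1) ∨
      (y = 3 ∧ y' = 3 ∧ p + 2 ≤ j ∧ j ≤ p + q - 2) ∨
      (y = 3 ∧ y' = 4 ∧ j = p + q - 1) ∨ (y = 4 ∧ y' = 5 ∧ j = p + q) := by
    rcases (by omega : j ≤ p - 2 ∨ j = p - 1 ∨ j = p ∨ j = p + 1 ∨ (p + 2 ≤ j ∧ j ≤ p + q - 2) ∨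
      j = p + q - 1 ∨ j = p + q) with h | h | h | h | h | h | h
    · exact .inl ⟨hy.trans (t0 _ (by omega) (by omega)), hy'.trans (t0 _ (by omega) (by omega)), h⟩
    · exact .inr (.inl ⟨hy.trans (t0 _ (by omega) (by omega)), hy'.trans (t1 _ (by omega)), h⟩)
    · exact .inr (.inr (.inl ⟨hy.trans (t1 _ h), hy'.trans (t2 _ (by omega)), h⟩))
    · exact .inr (.inr (.inr (.inl
        ⟨hy.trans (t2 _ h), hy'.trans (t3 _ (by omega) (by omega)), h⟩)))
    · exact .inr (.inr (.inr (.inr (.inl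
        ⟨hy.trans (t3 _ (by omega) (by omega)), hy'.trans (t3 _ (by omega) (by omega)), h⟩))))
    · exact .inr (.inr (.inr (.inr (.inr (.inl
        ⟨hy.trans (t3 _ (by omega) (by omega)), hy'.trans (t4 _ (by omega)), h⟩)))))
    · exact .inr (.inr (.inr (.inr (.inr (.inr
        ⟨hy.trans (t4 _ h), hy'.trans (t5 _ (by omega)), h⟩)))))
  clear hx hx' hy hy' t0 t1 t2 t3 t4 t5
  rcases iv with ⟨rfl, rfl, e⟩ | ⟨rfl, rfl, e⟩ | ⟨rfl, rfl, e⟩ | ⟨rfl, rfl, e⟩ <;>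
    rcases jv with ⟨rfl, rfl, e'⟩ | ⟨rfl, rfl, e'⟩ | ⟨rfl, rfl, e'⟩ | ⟨rfl, rfl, e'⟩ |
      ⟨rfl, rfl, e'⟩ | ⟨rfl, rfl, e'⟩ | ⟨rfl, rfl, e'⟩ <;>
    omega

/-- Additivity on a square with `x = a (i + 1) j` and `y`, `z` the two outer values at `(i, j + 1)`,
when the tripod contributes `ε` to `x` and `y` but not to `z`: since `z ≤ x`, the value `z` never
decides a maximum. -/
theorem max_min_add_of_le {x y z ε : ℝ} (hε : 0 ≤ ε) (h : z ≤ x) :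
    max (x + ε) (max (y + ε) (z + 0)) = max x (max y z) + max ε (max ε 0) ∧
      min (y + ε) (x + ε) = min y x + min ε ε ∧ min (z + 0) (x + ε) = min z x + min 0 ε := by
  refine ⟨?_, ?_, ?_⟩
  · have h' : z ≤ max x y := h.trans (le_max_left x y)
    rw [← max_assoc, ← max_assoc x, max_add_add_right, add_zero, max_eq_left h', max_eq_left hε,
      max_self, max_eq_left (by linarith)]
  · rw [min_add_add_right, min_self]
  · rw [min_eq_left h, min_eq_left hε, min_eq_left (by linarith)]

/-- The companion case, where the tripod contributes `ε` to `y` alone: harmless because `y` already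
attains the maximum. -/
theorem max_min_add_of_ge {x y z ε : ℝ} (hε : 0 ≤ ε) (h : x ≤ y) (h' : z ≤ y) :
    max (x + 0) (max (y + ε) (z + 0)) = max x (max y z) + max 0 (max ε 0) ∧
      min (y + ε) (x + 0) = min y x + min ε 0 ∧ min (z + 0) (x + 0) = min z x + min 0 0 := by
  refine ⟨?_, ?_, ?_⟩
  · rw [max_eq_left h', max_eq_right h, max_eq_left hε, max_eq_right hε,
      max_eq_left (a := y + ε) (by linarith), max_eq_right (by linarith)]
  · rw [min_eq_right h, min_eq_right hε, min_eq_right (by linarith)]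
  · simp

namespace IsGrowth

variable {q n : ℤ} {N : ℝ} {a b c : ℤ → ℤ → ℝ}

/-- The growth diagram of a single edge of weight `ε`. -/
theorem edge_two {ε : ℝ} (hε : 0 ≤ ε) :
    IsGrowth 2 ε (fun i j => if i < j then ε else 0) (fun i j => if i + 2 ≤ j then ε else 0)
      (fun i j => if i + 2 ≤ j then ε else 0) := by
  refine ⟨by norm_num, by simp, by simp, by simp, by simp, by simp, by simp, by simp, ?_, ?_, ?_,
    fun i j h1 h2 => ?_⟩
  · intro i j; simp only [show i + 2 + 2 ≤ j + 2 ↔ i + 2 ≤ j by omega]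
  · intro i j; simp only [show i + 2 + 2 ≤ j + 2 ↔ i + 2 ≤ j by omega]
  · refine ⟨by simp, by simp, by simp, by simp, by simp, by simp, ?_, ?_, ?_, ?_, ?_⟩ <;>
      intro j h1 h2 <;> split_ifs <;> first | exact le_rfl | exact hε | omega
  · obtain rfl : j = i + 1 := by omega
    have e1 : ¬ i + 2 ≤ i + 1 := by omega
    have e2 : i + 2 ≤ i + 1 + 1 := by omega
    have e3 : i < i + 1 + 1 := by omega
    constructor <;> simp [e1, e2, e3, hε]

/-- The growth diagram of a tripod of weight `ε`. -/
theorem tripod_three {ε : ℝ} (hε : 0 ≤ ε) :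
    IsGrowth 3 ε (fun i j => if i < j then ε else 0)
      (fun i j => if i + 3 ≤ j ∨ i + 2 = j ∧ i % 2 = 0 then ε else 0)
      (fun i j => if i + 3 ≤ j ∨ i + 2 = j ∧ i % 2 = 1 then ε else 0) := by
  refine ⟨by norm_num, by simp, by simp, by simp, by simp, by simp, by simp, by simp, ?_, ?_, ?_,
    fun i j h1 h2 => ?_⟩
  -- The period 3 is odd, so a shift by one period changes the parity of `i`, which exchanges `b`
  -- and `c`.
  · intro i j
    simp only [show (i + 3 + 3 ≤ j + 3 ∨ i + 3 + 2 = j + 3 ∧ (i + 3) % 2 = 0) ↔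
      (i + 3 ≤ j ∨ i + 2 = j ∧ i % 2 = 1) by omega]
  · intro i j
    simp only [show (i + 3 + 3 ≤ j + 3 ∨ i + 3 + 2 = j + 3 ∧ (i + 3) % 2 = 1) ↔
      (i + 3 ≤ j ∨ i + 2 = j ∧ i % 2 = 0) by omega]
  · refine ⟨by simp, by simp, by simp, by simp, by simp, by simp, ?_, ?_, ?_, ?_, ?_⟩ <;>
      intro j h1 h2 <;> split_ifs <;> first | exact le_rfl | exact hε | omega
  · have e0 : i % 2 = 0 ∨ i % 2 = 1 := by omega
    obtain rfl | rfl : j = i + 1 ∨ j = i + 2 := by omega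
    · have e1 : ¬ i + 3 ≤ i + 1 := by omega
      have e2 : ¬ i + 3 ≤ i + 1 + 1 := by omega
      have e3 : i < i + 1 + 1 := by omega
      have e4 : i + 2 = i + 1 + 1 := by omega
      have e5 : ¬ i + 1 + 3 ≤ i + 1 + 1 := by omega
      rcases e0 with e0 | e0 <;> constructor <;> simp [e1, e2, e3, e4, e5, e0, hε]
    · have e2 : i + 3 ≤ i + 2 + 1 := by omega
      have e3 : i < i + 2 + 1 := by omega
      have e4 : i + 1 + 2 = i + 2 + 1 := by omega
      have e5 : ¬ i + 1 + 3 ≤ i + 2 + 1 := by omega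
      have e6 : ¬ i + 3 ≤ i + 2 := by omega
      have e7 : i + 1 < i + 2 + 1 := by omega
      have e8 : i + 1 < i + 2 := by omega
      have e9 : (i + 1) % 2 = 1 - i % 2 := by omega
      have e10 : ¬ i + 1 + 3 ≤ i + 2 := by omega
      rcases e0 with e0 | e0 <;> constructor <;>
        simp [e2, e3, e4, e5, e6, e7, e8, e9, e10, e0]

/-- Adding an edge at the sites `p` and `p + 1`. -/
theorem add_edge (h : IsGrowth q N a b c) {p : ℤ} (hp : 1 ≤ p) (hpq : p + 1 ≤ q) {ε : ℝ}
    (hε : 0 ≤ ε) : ∃ a' b' c', IsGrowth q (N + ε) a' b' c' ∧ ∀ j, 0 ≤ j → j ≤ q →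
      a' 0 j = a 0 j + (if p ≤ j then ε else 0) ∧ b' 0 j = b 0 j + (if p + 1 ≤ j then ε else 0) ∧
      c' 0 j = c 0 j + (if p + 1 ≤ j then ε else 0) := by
  have hq := h.q_pos
  let ι : ℤ → ℤ := fun i => siteCount q p i + siteCount q (p + 1) i
  have hι : ∀ i, ι (i + q) = ι i + 2 := fun i => by simp only [ι, siteCount_add hq]; ring
  have V : ∀ i, (p + 1 - q ≤ i → i < p → ι i = 0) ∧ (i = p → ι i = 1) ∧
      (p + 1 ≤ i → i < p + q → ι i = 2) ∧ (i = p + q → ι i = 3) ∧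
      (p + 1 + q ≤ i → i < p + q + q → ι i = 4) := fun i => by
    have s1 := siteCount_spec hq p i
    have s2 := siteCount_spec hq (p + 1) i
    simp only [ι]
    omega
  have g := (edge_two hε).pull hq hι 0 fun i h1 h2 => by
    have := V i
    have := V (i + 1)
    omega
  refine ⟨_, _, _, h.add g 0 fun i j h1 h2 h3 h4 => ?_, fun j h1 h2 => ?_⟩
  · have v1 := V i
    have v2 := V (i + 1)
    have v3 := V j
    have v4 := V (j + 1)
    -- Only two squares see unequal contributions of the edge. On this one the edge adds `ε` to the
    -- `b`- and `c`-values but not to `a (i + 1) j`, which lies on the diagonal and is `0`, the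
    -- least of the three.
    by_cases H1 : i = p - 1 ∧ j = p
    · right
      obtain ⟨rfl, rfl⟩ := H1
      have e1 : ι (j - 1) = 0 := by omega
      have e2 : ι (j + 1) = 2 := by omega
      have eb := (h.path (j - 1)).b_nonneg (j := j + 1) (by omega) (by omega)
      have ec := (h.path (j - 1)).c_nonneg (j := j + 1) (by omega) (by omega)
      have := le_max_left (b (j - 1) (j + 1)) (c (j - 1) (j + 1))
      simp only [sub_add_cancel, h.a_zero, e1, e2, lt_irrefl, if_false, zero_add, le_refl, if_true,
        max_add_add_right, max_self, max_eq_right hε, min_eq_right hε, min_eq_right eb,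
        min_eq_right ec, min_eq_right (add_nonneg eb hε), min_eq_right (add_nonneg ec hε), add_zero]
      rw [max_eq_right (eb.trans this), max_eq_right (add_nonneg (eb.trans this) hε)]
      simp
    -- Here again only the `b`- and `c`-values receive `ε`, and both are already equal to the
    -- maximum `N`.
    by_cases H2 : i = p ∧ j = p + q - 1
    · right
      obtain ⟨rfl, rfl⟩ := H2
      have e1 : ι (i + q - 1) = 2 := by omega
      have e2 : ι i = 1 := by omega
      have e3 : ι (i + 1) = 2 := by omega
      have e4 : ι (i + q) = 3 := (V (i + q)).2.2.2.1 rfl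
      have ea := (h.path (i + 1)).a_le_top (j := i + q - 1) (by omega) (by omega)
      simp only [sub_add_cancel, e1, e2, e3, e4, h.b_full, h.c_full, lt_irrefl, if_false,
        max_self, min_eq_right ea, add_zero]
      norm_num
      rw [max_eq_right ea, max_eq_right (by linarith), min_eq_right (by linarith)]
      simp [hε]
    · left
      have key : ι (i + 1) < ι j ↔ ι i + 2 ≤ ι (j + 1) := by omega
      simp only [key, and_self]
  · have v1 := V 0
    have v2 := V j
    have e1 : ι 0 < ι j ↔ p ≤ j := by omega
    have e2 : ι 0 + 2 ≤ ι j ↔ p + 1 ≤ j := by omega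
    simp only [e1, e2, and_self]

/-- Once row `i + 1` is full at `p`, the increments at the site `p + 1` propagate downwards. -/
theorem b_incr_eq (h : IsGrowth q N a b c) {i p : ℤ} (hip : i < p) (hpi : p < i + q)
    (ha : a (i + 1) p = N) : b i (p + 1) - b i p = b (i + 1) (p + 1) - b (i + 1) p := by
  have r := (h.rule i p hip hpi).rule_b
  rw [ha, min_eq_left ((h.path i).b_le_top (by omega) (by omega))] at r
  linarith

/-- In a fixed column the `a`-values do not decrease as the row index goes down, so the maximal
value `N` persists in the earlier rows that contain this column. -/
theorem rows_full (h : IsGrowth q N a b c) {p : ℤ} (hp : 1 ≤ p)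
    (ha : a 0 p = N) {i : ℤ} (hi : p - q ≤ i) (hi0 : i ≤ 0) :
    a i p = N := by
  induction i, hi0 using Int.leInductionDown with
  | base => exact ha
  | pred i hi0 ih =>
    have e := ih (by omega)
    have h1 := h.a_succ_le_a (i := i - 1) (j := p) (by omega) (by omega)
    rw [sub_add_cancel, e] at h1
    exact le_antisymm ((h.path _).a_le_top (by omega) (by omega)) h1

theorem rows_b_incr (h : IsGrowth q N a b c) {p : ℤ} (hp : 1 ≤ p)
    (ha : a 0 p = N) {i : ℤ} (hi : p + 1 - q ≤ i) (hi0 : i ≤ 0) :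
    b i (p + 1) - b i p = b 0 (p + 1) - b 0 p := by
  induction i, hi0 using Int.leInductionDown with
  | base => rfl
  | pred i hi0 ih =>
    rw [← ih (by omega)]
    have := h.b_incr_eq (i := i - 1) (p := p) (by omega) (by omega)
    rw [sub_add_cancel] at this
    exact this (h.rows_full hp ha (by omega) hi0)

/-- If in row `R = p + 1 - q` there is no `c`-increment at `p + 1`, then there is none in the rows
up to `p`. -/
theorem c_incr_zero (h : IsGrowth q N a b c) {p : ℤ} (hpR : c (p + 1 - q) (p + 1) = c (p + 1 - q) p)
    {i : ℤ} (hi : p + 1 - q ≤ i) (hip : i ≤ p) : c i (p + 1) = c i p := by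
  have hq := h.q_pos
  induction i, hi using Int.leInduction with
  | base => exact hpR
  | succ i hi ih =>
    have e := ih (by omega)
    have r := (h.rule i p (by omega) (by omega)).rule_c
    have := h.c_le_a_succ (i := i) (j := p) (by omega) (by omega)
    rw [e, min_eq_left this] at r
    linarith

/-- If `a` is full at `p` in row `p + 1 - q`, then `b` agrees in the rows `p` and `p + 1`. -/
theorem b_rows_eq (h : IsGrowth q N a b c) {p : ℤ} (hc : c (p + 1 - q) p = N)
    {J : ℤ} (hJ : p + 1 ≤ J) (hJq : J ≤ p + q) : b p J = b (p + 1) J := by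
  have hq := h.q_pos
  induction J, hJq using Int.leInductionDown with
  | base =>
    -- By the flip, `b (p + 1) (p + q)` is `c (p + 1 - q) p = N`, so both rows are full at the right
    -- end. The rule carries the equality leftwards, its minimum being decided by the chain
    -- condition of row `p + 1`.
    rw [h.b_full, ← hc, ← h.b_flip]
    ring_nf
  | pred J hJq ih =>
    have e := ih (by omega)
    have r := (h.rule p (J - 1) (by omega) (by omega)).rule_b
    have l := (h.path (p + 1)).b_le (J - 1) (by omega) (by omega)
    rw [sub_add_cancel] at r l
    rw [e, min_eq_left l] at r
    linarith

/-- Needed so that `c` attains the maximum on the square `(p, p + 1)` when a tripod is added.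
Through rows `p + 2 - q` to `p`, either `a` has no increment at `p + 1` or `b` has none at `p + 2`.
At row `p` both alternatives give the value `0`, since `a p p = 0` and `b p (p + 1) = 0`. -/
theorem b_add_two_eq_zero (h : IsGrowth q N a b c) {p : ℤ} (hp : 1 ≤ p) (hpq : p + 2 ≤ q)
    (ha : a 0 p = N) (C : ∀ i, p + 1 - q ≤ i → i ≤ p → c i (p + 1) = c i p) : b p (p + 2) = 0 := by
  have aR : ∀ i, p - q ≤ i → i ≤ 0 → a i p = N := fun i => h.rows_full hp ha
  have inv : ∀ i, p + 2 - q ≤ i → i ≤ p → a i (p + 1) = a i p ∨ b i (p + 2) = b i (p + 1) := by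
    intro i hi hip
    induction i, hi using Int.leInduction with
    | base =>
      left
      rw [aR _ (by omega) (by omega)]
      refine le_antisymm ((h.path _).a_le_top (by omega) (by omega)) ?_
      rw [← aR (p + 2 - q) (by omega) (by omega)]
      exact (h.path _).a_mono _ (by omega) (by omega)
    | succ i hi ih =>
      have e := ih (by omega)
      have r := h.rule i p (by omega) (by omega)
      have r' := h.rule i (p + 1) (by omega) (by omega)
      have ra := r.rule_a
      have rb' := r'.rule_b
      have l := h.c_le_a_succ (i := i) (j := p) (by omega) (by omega)
      have m := (h.path (i + 1)).b_mono (p + 1) (by omega) (by omega)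
      rw [add_assoc p] at rb' m
      rw [C i (by omega) (by omega)] at ra
      norm_num at rb' m
      rcases e with e | e
      · rcases le_total (b i (p + 1)) (a (i + 1) p) with l' | l'
        · left
          rw [max_eq_left (max_le l' l)] at ra
          linarith
        · right
          rw [max_eq_left (l.trans l'), max_eq_right l'] at ra
          have e' : a (i + 1) (p + 1) = b i (p + 1) := by linarith
          have m' := (h.path i).b_mono (p + 1) (by omega) (by omega)
          rw [add_assoc p] at m'
          norm_num at m'
          rw [e', min_eq_right m'] at rb'
          linarith
      · right
        rw [e] at rb'
        have := min_le_left (b i (p + 1)) (a (i + 1) (p + 1))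
        exact le_antisymm (by linarith) m
  have l := (h.path p).b_le (p + 1) (by omega) (by omega)
  have l' := (h.path p).b_nonneg (j := p + 2) (by omega) (by omega)
  rw [add_assoc p] at l
  norm_num at l
  rcases inv p (by omega) le_rfl with e | e
  · rw [e, h.a_zero] at l
    exact le_antisymm l l'
  · rw [e, h.b_succ]

/-- Adding a tripod at the sites `p`, `p + 1` and `p + 2`. -/
theorem add_tripod (h : IsGrowth q N a b c) {p : ℤ} (hp : 1 ≤ p) (hpq : p + 2 ≤ q)
    (ha : a 0 p = N) (hc : c 0 (p + 1) = c 0 p) {ε : ℝ} (hε : 0 ≤ ε) :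
    ∃ a' b' c', IsGrowth q (N + ε) a' b' c' ∧ ∀ j, 0 ≤ j → j ≤ q →
      a' 0 j = a 0 j + (if p ≤ j then ε else 0) ∧ b' 0 j = b 0 j + (if p + 1 ≤ j then ε else 0) ∧
      c' 0 j = c 0 j + (if p + 2 ≤ j then ε else 0) := by
  have hq := h.q_pos
  have hι : ∀ i, tripodCount q p (i + q) = tripodCount q p i + 3 := fun i => by
    simp only [tripodCount, siteCount_add hq]; ring
  have V := tripodCount_spec hp hpq
  have g := (tripod_three hε).pull hq hι (p + 2 - q) fun i h1 h2 => by
    have := V i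
    have := V (i + 1)
    omega
  have cR := h.swap.rows_b_incr hp ha (i := p + 1 - q) le_rfl (by omega)
  rw [hc, sub_self, sub_eq_zero] at cR
  -- Index `p + 1` is the right end of row `p + 1 - q`, and `c` has no increment there.
  have cN : c (p + 1 - q) p = N := by
    rw [← cR, ← h.c_full (p + 1 - q), sub_add_cancel]
  have C : ∀ i, p + 1 - q ≤ i → i ≤ p → c i (p + 1) = c i p := fun i => h.c_incr_zero cR
  have B : ∀ J, p + 1 ≤ J → J ≤ p + q → b p J = b (p + 1) J := fun J => h.b_rows_eq cN
  have b0 : b p (p + 2) = 0 := h.b_add_two_eq_zero hp hpq ha C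
  refine ⟨_, _, _, h.add g (p + 2 - q) fun i j h1 h2 h3 h4 => ?_, fun j h1 h2 => ?_⟩
  · have swapped : ∀ {x x' y y' z z' : ℝ},
        (max (x + x') (max (z + z') (y + y')) = max x (max z y) + max x' (max z' y') ∧
        min (z + z') (x + x') = min z x + min z' x' ∧
        min (y + y') (x + x') = min y x + min y' x') →
        (max (x + x') (max (y + y') (z + z')) = max x (max y z) + max x' (max y' z') ∧
        min (y + y') (x + x') = min y x + min y' x' ∧
        min (z + z') (x + x') = min z x + min z' x') := by
      rintro x x' y y' z z' ⟨e1, e2, e3⟩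
      exact ⟨by rw [max_comm (y + y'), e1, max_comm z, max_comm z'], e3, e2⟩
    -- On the first and fourth kinds the tripod misses exactly one outer value, which is at most `a
    -- (i + 1) j` (by `C`, respectively `B`). On the second, third and fifth it hits exactly one
    -- outer value, which is maximal: the competitors vanish in the second and third, and the value
    -- is `N` in the fifth.
    rcases tripodCount_square hp hpq h1 (by omega) h3 h4 rfl rfl rfl rfl with
      ⟨e, rfl, e1, e2, e3, e4⟩ | ⟨rfl, rfl, e1, e2, e3, e4⟩ | ⟨rfl, rfl, e1, e2, e3, e4⟩ |
      ⟨rfl, e, e1, e2, e3, e4⟩ | ⟨rfl, rfl, e1, e2, e3, e4⟩ | e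
    · right
      simp only [e1, e2, e3, e4]
      norm_num only [if_true, if_false]
      apply max_min_add_of_le hε
      rw [C i (by omega) (by omega)]
      exact h.c_le_a_succ (by omega) (by omega)
    · right
      simp only [e1, e2, e3, e4]
      norm_num only [if_true, if_false]
      have e1 := (h.path (j - 1)).b_nonneg (j := j + 1) (by omega) (by omega)
      have e2 := h.c_succ (j - 1)
      rw [sub_add_cancel] at e2 ⊢
      apply max_min_add_of_ge hε
      · rwa [h.a_zero]
      · rwa [C (j - 1) (by omega) (by omega), e2]
    · right
      simp only [e1, e2, e4]
      norm_num only [if_true, if_false]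
      have e1 := (h.path i).c_nonneg (j := i + 2) (by omega) (by omega)
      apply swapped
      rw [add_assoc i]
      norm_num only
      apply max_min_add_of_ge hε
      · rwa [h.a_zero]
      · rwa [b0]
    · right
      simp only [e1, e2, e3, e4]
      norm_num only [if_true, if_false]
      apply swapped
      apply max_min_add_of_le hε
      rw [B _ (by omega) (by omega)]
      exact (h.path _).b_le _ (by omega) (by omega)
    · right
      simp only [e1, e2, e3, e4]
      norm_num only [if_true, if_false]
      have e : b (p + 1) (p + q) = N := by rw [← B _ (by omega) (by omega), h.b_full]
      rw [sub_add_cancel]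
      apply max_min_add_of_ge hε <;> rw [e]
      · exact (h.path _).a_le_top (by omega) (by omega)
      · exact (h.path _).c_le_top (by omega) (by omega)
    · left
      simp only [e.1, e.2, and_self]
  · have v1 := V 0
    have v2 := V j
    generalize tripodCount q p 0 = x at *
    generalize tripodCount q p j = y at *
    have e1 : x < y ↔ p ≤ j := by omega
    have e2 : x + 3 ≤ y ∨ x + 2 = y ∧ x % 2 = 0 ↔ p + 1 ≤ j := by omega
    have e3 : x + 3 ≤ y ∨ x + 2 = y ∧ x % 2 = 1 ↔ p + 2 ≤ j := by omega
    simp only [e1, e2, e3, and_self]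

end IsGrowth

/-! ### Splitting a site in two -/

namespace IsGrowth

variable {q n : ℤ} {N : ℝ} {a b c : ℤ → ℤ → ℝ}

/-- The rule on the square to the left of the inserted column, as an identity of real numbers:
primes mark row `i + 1`, the index `1` marks the old column `p + 1`, unmarked letters belong to row
`i` and column `p`. As `C ≤ A'`, the value `C` never wins a maximum. `insert_col_right` treats the
square on the other side. -/
theorem insert_col_left {A B C A' B' C' A₁ B₁ A₁' B₁' β₂ : ℝ} (ra : A + A₁' = A₁ + max A' B₁)
    (rb : B + B₁' = B' + min B₁ A') (hC : C ≤ A') :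
    A + (A₁' - min (A₁' - A') β₂) = A₁ - min (A₁ - A) β₂ +
      max A' (max (B₁ - β₂ + min (A₁ - A) β₂) C) ∧
    B + (B₁' - β₂ + min (A₁' - A') β₂) = B' + min (B₁ - β₂ + min (A₁ - A) β₂) A' ∧
    C + C' = C' + min C A' := by
  refine ⟨?_, ?_, by rw [min_eq_left hC, add_comm]⟩
  · rw [max_comm _ C, ← max_assoc, max_eq_left hC]
    simp only [max_def, min_def] at *
    split_ifs at * <;> linarith
  · simp only [max_def, min_def] at *
    split_ifs at * <;> linarith

theorem insert_col_right {A C A' C' A₁ B₁ A₁' B₁' β₂ : ℝ} (ra : A + A₁' = A₁ + max A' B₁)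
    (hC : C ≤ A') :
    A₁ - min (A₁ - A) β₂ + A₁' = A₁ + max (A₁' - min (A₁' - A') β₂) (max B₁ C) ∧
    B₁ - β₂ + min (A₁ - A) β₂ + B₁' =
      B₁' - β₂ + min (A₁' - A') β₂ + min B₁ (A₁' - min (A₁' - A') β₂) ∧
    C + C' = C' + min C (A₁' - min (A₁' - A') β₂) := by
  have hm : A' ≤ A₁' - min (A₁' - A') β₂ := by linarith [min_le_left (A₁' - A') β₂]
  refine ⟨?_, ?_, by rw [min_eq_left (hC.trans hm), add_comm]⟩
  · rw [max_comm _ C, ← max_assoc, max_eq_left (hC.trans hm)]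
    simp only [max_def, min_def] at *
    split_ifs at * <;> linarith
  · simp only [max_def, min_def] at *
    split_ifs at * <;> linarith

/-- The same for the inserted row, with `P`, `Q` the `a`-values in two adjacent columns and primes
for the old row `p + 1`: this is the square between row `p` and the new row. `insert_row_above` is
the square between the new row and the old row `p + 1`. -/
theorem insert_row_below {P Q P' Q' C C' C₁ C₁' B B₁ β₂ : ℝ}
    (ra : P + Q' = Q + max P' C₁) (rc : C + C₁' = C' + min C₁ P') (hB : B₁ ≤ P') :
    P + (Q' + β₂ - min β₂ (C₁ - C₁')) =
      Q + max (P' + β₂ - min β₂ (C - C')) (max B₁ C₁) ∧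
    B + B₁ = B + min B₁ (P' + β₂ - min β₂ (C - C')) ∧
    C + (C₁' + min β₂ (C₁ - C₁')) =
      C' + min β₂ (C - C') + min C₁ (P' + β₂ - min β₂ (C - C')) := by
  have hm : P' ≤ P' + β₂ - min β₂ (C - C') := by linarith [min_le_left β₂ (C - C')]
  refine ⟨?_, by rw [min_eq_left (hB.trans hm)], ?_⟩
  · rw [← max_assoc, max_eq_left (hB.trans hm)]
    simp only [max_def, min_def] at *
    split_ifs at * <;> linarith
  · simp only [max_def, min_def] at *
    split_ifs at * <;> linarith

theorem insert_row_above {P' Q' C C' C₁ C₁' B B₁ β₂ : ℝ}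
    (rc : C + C₁' = C' + min C₁ P') (hB : B₁ ≤ P') :
    P' + β₂ - min β₂ (C - C') + Q' =
      Q' + β₂ - min β₂ (C₁ - C₁') + max P' (max B₁ (C₁' + min β₂ (C₁ - C₁'))) ∧
    B + B₁ = B + min B₁ P' ∧
    C' + min β₂ (C - C') + C₁' = C' + min (C₁' + min β₂ (C₁ - C₁')) P' := by
  refine ⟨?_, by rw [min_eq_left hB], ?_⟩
  · rw [← max_assoc, max_eq_left hB]
    simp only [max_def, min_def] at *
    split_ifs at * <;> linarith
  · simp only [min_def] at *
    split_ifs at * <;> linarith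

/-- If all increments other than `b` vanish at the site `p + 1`, this site can be split in two. -/
theorem insert (h : IsGrowth n N a b c) {p : ℤ} (hp : 1 ≤ p) (hpn : p + 1 ≤ n) (ha : a 0 p = N)
    (hc : c 0 (p + 1) = c 0 p) {β₂ : ℝ} (h₂ : 0 ≤ β₂) (hβ : β₂ ≤ b 0 (p + 1) - b 0 p) :
    ∃ a' b' c', IsGrowth (n + 1) N a' b' c' ∧ ∀ j, 0 ≤ j → j ≤ n + 1 →
      a' 0 j = a 0 (if j ≤ p + 1 then j else j - 1) ∧
      b' 0 j = b 0 (if j ≤ p + 1 then j else j - 1) - (if j = p + 1 then β₂ else 0) ∧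
      c' 0 j = c 0 (if j ≤ p + 1 then j else j - 1) := by
  have hn := h.q_pos
  have hq : 0 < n + 1 := by omega
  -- Away from the new row and column the diagram is the old one with the index `p + 1` repeated at
  -- `p + 2`.
  let ι : ℤ → ℤ := fun i => i - siteCount (n + 1) (p + 2) i
  have hι : ∀ i, ι (i + (n + 1)) = ι i + n := fun i => by simp only [ι, siteCount_add hq]; ring
  have V1 : ∀ i, p + 1 - n ≤ i → i ≤ p + 1 → ι i = i := fun i h1 h2 => by
    simp only [ι, (siteCount_spec hq (p + 2) i).1 (by omega) (by omega), sub_zero]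
  have V2 : ∀ i, p + 2 ≤ i → i ≤ p + n + 2 → ι i = i - 1 := fun i h1 h2 => by
    simp only [ι, (siteCount_spec hq (p + 2) i).2.1 (by omega) (by omega)]
  have aR : ∀ i, p - n ≤ i → i ≤ 0 → a i p = N := fun i => h.rows_full hp ha
  have aR' : ∀ i, p + 1 - n ≤ i → i ≤ 0 → a i (p + 1) = N := fun i h1 h2 => by
    refine le_antisymm ((h.path i).a_le_top (by omega) (by omega)) ?_
    rw [← aR i (by omega) h2]
    exact (h.path i).a_mono p (by omega) (by omega)
  have cR := h.swap.rows_b_incr hp ha (i := p + 1 - n) le_rfl (by omega)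
  rw [hc, sub_self, sub_eq_zero] at cR
  have cN : c (p + 1 - n) p = N := by
    rw [← cR, ← h.c_full (p + 1 - n), sub_add_cancel]
  have bR := h.rows_b_incr hp ha (i := p + 1 - n) le_rfl (by omega)
  have C : ∀ i, p + 1 - n ≤ i → i ≤ p → c i (p + 1) = c i p := fun i => h.c_incr_zero cR
  have B : ∀ J, p + 1 ≤ J → J ≤ p + n → b p J = b (p + 1) J := fun J => h.b_rows_eq cN
  -- The sum of the `a`- and `b`-increments at `p + 1` is the same in all these rows, because
  -- maximum plus minimum is the sum. In row `0` it consists of `b` alone, in row `p` of `a` alone.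
  have inv : a p (p + 1) = b 0 (p + 1) - b 0 p := by
    have key : ∀ i, p + 1 - n ≤ i → i ≤ p →
        a i (p + 1) - a i p + (b i (p + 1) - b i p) = b 0 (p + 1) - b 0 p := by
      intro i hi hip
      induction i, hi using Int.leInduction with
      | base => rw [bR, aR _ (by omega) (by omega), aR' _ (by omega) (by omega), sub_self, zero_add]
      | succ i hi ih =>
        have e := ih (by omega)
        have r := h.rule i p (by omega) (by omega)
        have ra := r.rule_a
        have rb := r.rule_b
        have l := h.c_le_a_succ (i := i) (j := p) (by omega) (by omega)
        rw [C i (by omega) (by omega), ← max_assoc, max_eq_left (l.trans (le_max_left _ _))] at ra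
        rw [min_comm] at rb
        have := max_add_min (a (i + 1) p) (b i (p + 1))
        linarith
    have := key p (by omega) le_rfl
    rwa [h.a_zero, h.b_zero, h.b_succ, sub_self, add_zero, sub_zero] at this
  -- The second of the two sites receives total increment `β₂`: as much as possible, `m i`, from
  -- `a`, and the remaining `β₂ - m i` from `b`.
  let m : ℤ → ℝ := fun i => min (a i (p + 1) - a i p) β₂
  -- Similarly the new row exceeds the old row `p + 1` by total `β₂`: `d j` in `c`, as much as row
  -- `p` permits, and `β₂ - d j` in `a`.
  let d : ℤ → ℝ := fun j => min β₂ (c p j - c (p + 1) j)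
  let u : ℤ → ℤ → ℝ := fun i j =>
    if i = p + 1 ∧ p + 2 ≤ j ∧ j ≤ p + n + 1 then a (p + 1) (j - 1) + β₂ - d (j - 1)
    else if i ≤ p ∧ j = p + 1 then a i (p + 1) - m i else a (ι i) (ι j)
  let v : ℤ → ℤ → ℝ := fun i j =>
    if i ≤ p ∧ j = p + 1 then b i (p + 1) - β₂ + m i else b (ι i) (ι j)
  -- The exceptional value `N - β₂` is forced by periodicity: row `p + 2` is the flip of row `p + 1
  -- - n`, whose new `b`-value at `p + 1` is `N - β₂`.
  let w : ℤ → ℤ → ℝ := fun i j =>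
    if i = p + 1 ∧ p + 2 ≤ j ∧ j ≤ p + n + 1 then c (p + 1) (j - 1) + d (j - 1)
    else if i = p + 2 ∧ j = p + n + 2 then N - β₂ else c (ι i) (ι j)
  have uL : ∀ i j, p + 1 - n ≤ i → i ≤ p → i ≤ j → j ≤ p →
      u i j = a i j ∧ v i j = b i j ∧ w i j = c i j := fun i j h1 h2 h3 h4 => by
    simp only [u, v, w]
    rw [if_neg (by omega), if_neg (by omega), if_neg (by omega), if_neg (by omega),
      if_neg (by omega), V1 i (by omega) (by omega), V1 j (by omega) (by omega)]
    exact ⟨rfl, rfl, rfl⟩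
  have uE : ∀ i, p + 1 - n ≤ i → i ≤ p → u i (p + 1) = a i (p + 1) - m i ∧
      v i (p + 1) = b i (p + 1) - β₂ + m i ∧ w i (p + 1) = c i p := fun i h1 h2 => by
    refine ⟨(if_neg (by omega)).trans (if_pos ⟨h2, rfl⟩), if_pos ⟨h2, rfl⟩,
      (if_neg (by omega)).trans ((if_neg (by omega)).trans ?_)⟩
    rw [V1 i (by omega) (by omega), V1 (p + 1) (by omega) (by omega), C i h1 h2]
  have uR : ∀ i j, p + 1 - n ≤ i → i ≤ p → p + 2 ≤ j → j ≤ p + n + 2 →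
      u i j = a i (j - 1) ∧ v i j = b i (j - 1) ∧ w i j = c i (j - 1) := fun i j h1 h2 h3 h4 => by
    simp only [u, v, w]
    rw [if_neg (by omega), if_neg (by omega), if_neg (by omega), if_neg (by omega),
      if_neg (by omega), V1 i (by omega) (by omega), V2 j (by omega) (by omega)]
    exact ⟨rfl, rfl, rfl⟩
  have uF : ∀ j, p + 2 ≤ j → j ≤ p + n + 1 → u (p + 1) j = a (p + 1) (j - 1) + β₂ - d (j - 1) ∧
      v (p + 1) j = b (p + 1) (j - 1) ∧ w (p + 1) j = c (p + 1) (j - 1) + d (j - 1) :=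
      fun j h1 h2 => by
    refine ⟨if_pos ⟨rfl, h1, h2⟩, (if_neg (by omega)).trans ?_, if_pos ⟨rfl, h1, h2⟩⟩
    rw [V1 (p + 1) (by omega) (by omega), V2 j (by omega) (by omega)]
  have u0 : u (p + 1) (p + 1) = 0 ∧ v (p + 1) (p + 1) = 0 ∧ w (p + 1) (p + 1) = 0 := by
    simp only [u, v, w]
    rw [if_neg (by omega), if_neg (by omega), if_neg (by omega), if_neg (by omega),
      if_neg (by omega), h.a_zero, h.b_zero, h.c_zero]
    exact ⟨rfl, rfl, rfl⟩
  have uN : u (p + 1) (p + n + 2) = N ∧ v (p + 1) (p + n + 2) = N ∧ w (p + 1) (p + n + 2) = N := by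
    simp only [u, v, w]
    rw [if_neg (by omega), if_neg (by omega), if_neg (by omega), if_neg (by omega),
      if_neg (by omega), V1 (p + 1) (by omega) (by omega), V2 (p + n + 2) (by omega) (by omega),
      show p + n + 2 - 1 = p + 1 + n by ring, h.a_full, h.b_full, h.c_full]
    exact ⟨rfl, rfl, rfl⟩
  have uB : ∀ j, p + 2 ≤ j → j ≤ p + n + 1 → u (p + 2) j = a (p + 1) (j - 1) ∧
      v (p + 2) j = b (p + 1) (j - 1) ∧ w (p + 2) j = c (p + 1) (j - 1) := fun j h1 h2 => by
    simp only [u, v, w]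
    rw [if_neg (by omega), if_neg (by omega), if_neg (by omega), if_neg (by omega),
      if_neg (by omega), V2 (p + 2) (by omega) (by omega), V2 j (by omega) (by omega),
      show p + 2 - 1 = p + 1 by ring]
    exact ⟨rfl, rfl, rfl⟩
  have uBN : u (p + 2) (p + n + 2) = N ∧ v (p + 2) (p + n + 2) = N ∧
      w (p + 2) (p + n + 2) = N - β₂ := by
    have e1 := V2 (p + 2) (by omega) (by omega)
    have e2 := V2 (p + n + 2) (by omega) (by omega)
    rw [show p + n + 2 - 1 = p + 1 + n by ring] at e2
    rw [show p + 2 - 1 = p + 1 by ring] at e1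
    refine ⟨(if_neg (by omega)).trans ((if_neg (by omega)).trans ?_), (if_neg (by omega)).trans ?_,
      (if_neg (by omega)).trans (if_pos ⟨rfl, rfl⟩)⟩
    · rw [e1, e2, h.a_full]
    · rw [e1, e2, h.b_full]
  have mR : ∀ i, p + 1 - n ≤ i → i ≤ 0 → m i = 0 := fun i h1 h2 => by
    simp only [m]
    rw [aR i (by omega) h2, aR' i h1 h2, sub_self, min_eq_left h₂]
  have row_zero : ∀ j, 0 ≤ j → j ≤ n + 1 →
      u 0 j = a 0 (if j ≤ p + 1 then j else j - 1) ∧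
      v 0 j = b 0 (if j ≤ p + 1 then j else j - 1) - (if j = p + 1 then β₂ else 0) ∧
      w 0 j = c 0 (if j ≤ p + 1 then j else j - 1) := fun j h1 h2 => by
    rcases lt_trichotomy j (p + 1) with h3 | rfl | h3
    · rw [if_pos h3.le, if_neg h3.ne, sub_zero]
      exact uL 0 j (by omega) (by omega) h1 (by omega)
    · rw [if_pos le_rfl, if_pos rfl]
      have := uE 0 (by omega) (by omega)
      rwa [mR 0 (by omega) le_rfl, sub_zero, add_zero, ← hc] at this
    · rw [if_neg (by omega), if_neg (by omega), sub_zero]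
      exact uR 0 j (by omega) (by omega) (by omega) (by omega)
  have R1 : ∀ {i : ℤ}, p + 1 - n ≤ i → i < p + 1 - n + (n + 1) → i ≤ p ∨ i = p + 1 := by omega
  have full : ∀ i, p + 1 - n ≤ i → i < p + 1 - n + (n + 1) →
      u i (i + (n + 1)) = N ∧ v i (i + (n + 1)) = N ∧ w i (i + (n + 1)) = N := fun i h1 h2 => by
    rcases R1 h1 h2 with h3 | rfl
    · have := uR i (i + (n + 1)) h1 h3 (by omega) (by omega)
      rwa [show i + (n + 1) - 1 = i + n by ring, h.a_full, h.b_full, h.c_full] at this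
    · rw [show p + 1 + (n + 1) = p + n + 2 by ring]
      exact uN
  have zero : ∀ i, p + 1 - n ≤ i → i < p + 1 - n + (n + 1) →
      u i i = 0 ∧ v i i = 0 ∧ w i i = 0 := fun i h1 h2 => by
    rcases R1 h1 h2 with h3 | rfl
    · have := uL i i h1 h3 le_rfl h3
      rwa [h.a_zero, h.b_zero, h.c_zero] at this
    · exact u0
  have path : IsVPath 0 (n + 1) N (u 0) (v 0) (w 0) := by
    have f := full 0 (by omega) (by omega)
    have z := zero 0 (by omega) (by omega)
    have P := h.path_zero
    have key : ∀ j, 0 ≤ j → j < 0 + (n + 1) → u 0 j ≤ u 0 (j + 1) ∧ v 0 j ≤ v 0 (j + 1) ∧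
        w 0 j ≤ w 0 (j + 1) ∧ v 0 (j + 1) ≤ u 0 j ∧ w 0 (j + 1) ≤ u 0 j := fun j h1 h2 => by
      obtain ⟨e1, e2, e3⟩ := row_zero j (by omega) (by omega)
      obtain ⟨e4, e5, e6⟩ := row_zero (j + 1) (by omega) (by omega)
      rw [e1, e2, e3, e4, e5, e6]
      rcases (by omega : j ≤ p - 1 ∨ j = p ∨ j = p + 1 ∨ p + 2 ≤ j) with h3 | h3 | h3 | h3
      · rw [if_pos (by omega), if_pos (by omega), if_neg (by omega), if_neg (by omega), sub_zero,
          sub_zero]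
        exact ⟨P.a_mono j h1 (by omega), P.b_mono j h1 (by omega), P.c_mono j h1 (by omega),
          P.b_le j h1 (by omega), P.c_le j h1 (by omega)⟩
      · subst j
        rw [if_pos (by omega), if_pos (by omega), if_neg (by omega), if_pos rfl, sub_zero]
        have := P.b_le p h1 (by omega)
        exact ⟨P.a_mono p h1 (by omega), by linarith, P.c_mono p h1 (by omega),
          by linarith, P.c_le p h1 (by omega)⟩
      · subst j
        rw [if_pos (by omega), if_neg (by omega), if_pos rfl, if_neg (by omega), sub_zero,
          add_sub_cancel_right]
        exact ⟨le_rfl, by linarith, le_rfl, P.b_le_a h1 (by omega), P.c_le_a h1 (by omega)⟩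
      · rw [if_neg (by omega), if_neg (by omega), if_neg (by omega), if_neg (by omega), sub_zero,
          sub_zero, show j + 1 - 1 = j - 1 + 1 by ring]
        exact ⟨P.a_mono _ (by omega) (by omega), P.b_mono _ (by omega) (by omega),
          P.c_mono _ (by omega) (by omega), P.b_le _ (by omega) (by omega),
          P.c_le _ (by omega) (by omega)⟩
    exact ⟨z.1, z.2.1, z.2.2, f.1, f.2.1, f.2.2, fun j h1 h2 => (key j h1 h2).1,
      fun j h1 h2 => (key j h1 h2).2.1, fun j h1 h2 => (key j h1 h2).2.2.1,
      fun j h1 h2 => (key j h1 h2).2.2.2.1, fun j h1 h2 => (key j h1 h2).2.2.2.2⟩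
  have bN : b (p + 1 - n) (p + 1) = N := by
    rw [← h.b_full (p + 1 - n), sub_add_cancel]
  have flip : ∀ j, u (p + 1 - n + (n + 1)) (j + (n + 1)) = u (p + 1 - n) j ∧
      v (p + 1 - n + (n + 1)) (j + (n + 1)) = w (p + 1 - n) j ∧
      w (p + 1 - n + (n + 1)) (j + (n + 1)) = v (p + 1 - n) j := fun j => by
    have f1 := h.a_flip (ι (p + 1 - n)) (ι j)
    have f2 := h.b_flip (ι (p + 1 - n)) (ι j)
    have f3 := h.c_flip (ι (p + 1 - n)) (ι j)
    rw [← hι, ← hι] at f1 f2 f3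
    have m0 := mR (p + 1 - n) le_rfl (by omega)
    simp only [u, v, w, f1, f2, f3, m0]
    have e0 : ι (p + 1 - n) = p + 1 - n := V1 _ (by omega) (by omega)
    have e1 : ι (p + 1) = p + 1 := V1 _ (by omega) (by omega)
    by_cases hj : j = p + 1
    · subst j
      rw [e0, e1, bN]
      split_ifs <;> first | omega | simp
    · split_ifs <;> first | omega | simp
  suffices rule : ∀ i j, p + 1 - n ≤ i → i < p + 1 - n + (n + 1) → i < j → j < i + (n + 1) →
      SquareRule u v w i j by
    obtain ⟨a', b', c', g', ea, eb, ec⟩ := exists_of_window (u := u) (v := v) (w := w) (N := N) hq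
      (R := p + 1 - n) (by omega) (by omega) (fun i h1 h2 => (zero i h1 h2).1)
      (fun i h1 h2 => (zero i h1 h2).2.1) (fun i h1 h2 => (zero i h1 h2).2.2)
      (fun i h1 h2 => (full i h1 h2).1) (fun i h1 h2 => (full i h1 h2).2.1)
      (fun i h1 h2 => (full i h1 h2).2.2) (fun j => (flip j).1) (fun j => (flip j).2.1)
      (fun j => (flip j).2.2) path rule
    refine ⟨a', b', c', g', ?_⟩
    rwa [ea, eb, ec]
  intro i j h1 h2 h3 h4
  have ofEq : ∀ {i j i' j' : ℤ}, u i j = a i' j' ∧ v i j = b i' j' ∧ w i j = c i' j' →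
      u (i + 1) j = a (i' + 1) j' ∧ v (i + 1) j = b (i' + 1) j' ∧ w (i + 1) j = c (i' + 1) j' →
      u i (j + 1) = a i' (j' + 1) ∧ v i (j + 1) = b i' (j' + 1) ∧ w i (j + 1) = c i' (j' + 1) →
      u (i + 1) (j + 1) = a (i' + 1) (j' + 1) ∧ v (i + 1) (j + 1) = b (i' + 1) (j' + 1) ∧
        w (i + 1) (j + 1) = c (i' + 1) (j' + 1) → SquareRule a b c i' j' →
      SquareRule u v w i j := by
    rintro i j i' j' ⟨e1, e2, e3⟩ ⟨e4, e5, e6⟩ ⟨e7, e8, e9⟩ ⟨e10, e11, e12⟩ r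
    constructor <;> simp only [e1, e2, e3, e4, e5, e6, e7, e8, e9, e10, e11, e12]
    exacts [r.rule_a, r.rule_b, r.rule_c]
  -- Squares not touching the new column or row come from the old diagram through `ofEq`. The
  -- corners `(p, p + 1)` and `(p + 1, p + n + 1)` follow from boundary values, and the rest from
  -- the four identities above.
  rcases R1 h1 h2 with h5 | h5
  · rcases h5.lt_or_eq with h5 | h5
    · have rA := (h.rule i p h5 (by omega)).rule_a
      have rB := (h.rule i p h5 (by omega)).rule_b
      have l := h.c_le_a_succ (i := i) (j := p) (by omega) (by omega)
      rw [C i (by omega) (by omega), ← max_assoc, max_eq_left (l.trans (le_max_left _ _))] at rA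
      rcases (by omega : j ≤ p - 1 ∨ j = p ∨ j = p + 1 ∨ p + 2 ≤ j) with h6 | h6 | h6 | h6
      · exact ofEq (uL _ _ (by omega) (by omega) (by omega) (by omega))
          (uL _ _ (by omega) (by omega) (by omega) (by omega))
          (uL _ _ (by omega) (by omega) (by omega) (by omega))
          (uL _ _ (by omega) (by omega) (by omega) (by omega)) (h.rule _ _ h3 (by omega))
      · subst j
        obtain ⟨x1, x2, x3⟩ := uL i p (by omega) (by omega) (by omega) (by omega)
        obtain ⟨x4, x5, x6⟩ := uL (i + 1) p (by omega) (by omega) (by omega) (by omega)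
        obtain ⟨y1, y2, y3⟩ := uE i (by omega) (by omega)
        obtain ⟨y4, y5, y6⟩ := uE (i + 1) (by omega) (by omega)
        obtain ⟨e1, e2, e3⟩ := insert_col_left (C' := c (i + 1) p) (β₂ := β₂) rA rB l
        constructor <;> simp only [x1, x2, x3, x4, x5, x6, y1, y2, y3, y4, y5, y6] <;> assumption
      · subst j
        obtain ⟨x1, x2, x3⟩ := uR i (p + 1 + 1) (by omega) (by omega) (by omega) (by omega)
        obtain ⟨x4, x5, x6⟩ := uR (i + 1) (p + 1 + 1) (by omega) (by omega) (by omega) (by omega)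
        rw [add_sub_cancel_right] at x1 x2 x3 x4 x5 x6
        rw [C _ (by omega) (by omega)] at x3 x6
        obtain ⟨y1, y2, y3⟩ := uE i (by omega) (by omega)
        obtain ⟨y4, y5, y6⟩ := uE (i + 1) (by omega) (by omega)
        obtain ⟨e1, e2, e3⟩ := insert_col_right (C' := c (i + 1) p) (β₂ := β₂) rA l
        constructor <;> simp only [x1, x2, x3, x4, x5, x6, y1, y2, y3, y4, y5, y6] <;> assumption
      · have s1 : j - 1 + 1 = j + 1 - 1 := by ring
        refine ofEq (uR _ _ (by omega) (by omega) (by omega) (by omega))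
          (uR _ _ (by omega) (by omega) (by omega) (by omega)) ?_ ?_
          (h.rule _ _ (by omega) (by omega)) <;> rw [s1]
        · exact uR _ _ (by omega) (by omega) (by omega) (by omega)
        · exact uR _ _ (by omega) (by omega) (by omega) (by omega)
    · subst i
      rcases (by omega : j = p + 1 ∨ p + 2 ≤ j) with h6 | h6
      · subst j
        obtain ⟨x1, x2, x3⟩ := uR p (p + 1 + 1) (by omega) (by omega) (by omega) (by omega)
        obtain ⟨x4, x5, x6⟩ := uF (p + 1 + 1) (by omega) (by omega)
        obtain ⟨y1, y2, y3⟩ := uE p (by omega) (by omega)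
        obtain ⟨y4, y5, y6⟩ := u0
        -- By `inv`, the `a`-increment in row `p` is large enough to supply all of `β₂`.
        have mp : m p = β₂ := by
          simp only [m]
          rw [h.a_zero, sub_zero, inv, min_eq_right hβ]
        have dp : d (p + 1) = 0 := by
          simp only [d]
          rw [h.c_succ, h.c_zero, sub_zero, min_eq_right h₂]
        rw [add_sub_cancel_right] at x1 x2 x3 x4 x5 x6
        constructor <;> simp only [x1, x2, x3, x4, x5, x6, y1, y2, y3, y4, y5, y6, mp, dp, h.a_zero,
          h.b_zero, h.c_zero, h.b_succ, h.c_succ] <;> simp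
      · obtain ⟨k, rfl⟩ : ∃ k, j = k + 1 := ⟨j - 1, by ring⟩
        have rA := (h.rule p k (by omega) (by omega)).rule_a
        have rC := (h.rule p k (by omega) (by omega)).rule_c
        have l := (h.path (p + 1)).b_le k (by omega) (by omega)
        rw [B _ (by omega) (by omega), ← max_assoc, max_eq_left l] at rA
        obtain ⟨x1, x2, x3⟩ := uR p (k + 1) (by omega) (by omega) (by omega) (by omega)
        obtain ⟨x4, x5, x6⟩ := uF (k + 1) (by omega) (by omega)
        obtain ⟨y1, y2, y3⟩ := uR p (k + 1 + 1) (by omega) (by omega) (by omega) (by omega)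
        obtain ⟨y4, y5, y6⟩ := uF (k + 1 + 1) (by omega) (by omega)
        rw [add_sub_cancel_right] at x1 x2 x3 x4 x5 x6 y1 y2 y3 y4 y5 y6
        rw [B _ (by omega) (by omega)] at x2 y2
        obtain ⟨e1, e2, e3⟩ := insert_row_below (B := b (p + 1) k) (β₂ := β₂) rA rC l
        constructor <;> simp only [x1, x2, x3, x4, x5, x6, y1, y2, y3, y4, y5, y6] <;> assumption
  · subst i
    rcases (by omega : j = p + n + 1 ∨ j ≤ p + n) with h6 | h6
    · subst j
      obtain ⟨x1, x2, x3⟩ := uF (p + n + 1) (by omega) (by omega)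
      obtain ⟨x4, x5, x6⟩ := uB (p + n + 1) (by omega) (by omega)
      obtain ⟨y1, y2, y3⟩ := uN
      obtain ⟨y4, y5, y6⟩ := uBN
      have f1 := h.a_flip (p + 1 - n) p
      have f2 := h.b_flip (p + 1 - n) p
      have f3 := h.c_flip (p + 1 - n) p
      rw [sub_add_cancel] at f1 f2 f3
      rw [aR _ (by omega) (by omega)] at f1
      rw [cN] at f2
      have dN : d (p + n) = β₂ := by
        simp only [d]
        rw [h.c_full, f3, min_eq_left]
        rwa [← bN, bR]
      rw [add_sub_cancel_right] at x1 x2 x3 x4 x5 x6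
      have s1 : p + 1 + 1 = p + 2 := by ring
      have s2 : p + n + 1 + 1 = p + n + 2 := by ring
      constructor <;> simp only [s1, s2, x1, x2, x3, x4, x5, x6, y1, y2, y3, y4, y5, y6, dN, f1, f2,
        f3] <;> simp
    · obtain ⟨k, rfl⟩ : ∃ k, j = k + 1 := ⟨j - 1, by ring⟩
      have rC := (h.rule p k (by omega) (by omega)).rule_c
      have l := (h.path (p + 1)).b_le k (by omega) (by omega)
      obtain ⟨x1, x2, x3⟩ := uF (k + 1) (by omega) (by omega)
      obtain ⟨x4, x5, x6⟩ := uB (k + 1) (by omega) (by omega)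
      obtain ⟨y1, y2, y3⟩ := uF (k + 1 + 1) (by omega) (by omega)
      obtain ⟨y4, y5, y6⟩ := uB (k + 1 + 1) (by omega) (by omega)
      rw [add_sub_cancel_right] at x1 x2 x3 x4 x5 x6 y1 y2 y3 y4 y5 y6
      have s1 : p + 1 + 1 = p + 2 := by ring
      obtain ⟨e1, e2, e3⟩ := insert_row_above (Q' := a (p + 1) (k + 1)) (B := b (p + 1) k)
        (β₂ := β₂) rC l
      constructor <;> simp only [s1, x1, x2, x3, x4, x5, x6, y1, y2, y3, y4, y5, y6] <;> assumption

end IsGrowth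

/-! ### Every chain is a row of a growth diagram -/

/-- The chain `(a, b, c)` is row `0` of a growth diagram. -/
def HasGrowth (q : ℤ) (N : ℝ) (a b c : ℤ → ℝ) : Prop :=
  ∃ a' b' c', IsGrowth q N a' b' c' ∧
    ∀ j, 0 ≤ j → j ≤ q → a' 0 j = a j ∧ b' 0 j = b j ∧ c' 0 j = c j

theorem HasGrowth.swap {q : ℤ} {N : ℝ} {a b c : ℤ → ℝ} (h : HasGrowth q N a b c) :
    HasGrowth q N a c b := by
  obtain ⟨a', b', c', g, e⟩ := h
  exact ⟨a', c', b', g.swap, fun j h1 h2 => ⟨(e j h1 h2).1, (e j h1 h2).2.2, (e j h1 h2).2.1⟩⟩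

/-- The number of proper increments of `f` on `[0, q]`. -/
noncomputable def incrCount (q : ℤ) (f : ℤ → ℝ) : ℕ :=
  ((Finset.Ico 0 q).filter fun j => f j < f (j + 1)).card

theorem incrCount_sub_le (q : ℤ) (f : ℤ → ℝ) (s : ℤ) {ε : ℝ} (hε : 0 ≤ ε) :
    incrCount q (fun j => f j - if s ≤ j then ε else 0) ≤ incrCount q f := by
  refine Finset.card_le_card (Finset.monotone_filter_right _ fun j _ hj => ?_)
  dsimp only at hj
  split_ifs at hj <;> first | omega | linarith

theorem incrCount_sub_lt {q : ℤ} {f : ℤ → ℝ} {s : ℤ} (hs : 1 ≤ s) (hsq : s ≤ q) {ε : ℝ} (hε : 0 < ε)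
    (h : f s - f (s - 1) = ε) :
    incrCount q (fun j => f j - if s ≤ j then ε else 0) < incrCount q f := by
  refine Finset.card_lt_card (Finset.ssubset_iff_of_subset ?_ |>.2 ⟨s - 1, ?_, ?_⟩)
  · refine Finset.monotone_filter_right _ fun j _ hj => ?_
    dsimp only at hj
    split_ifs at hj <;> first | omega | linarith
  · rw [Finset.mem_filter, Finset.mem_Ico, sub_add_cancel]
    exact ⟨by omega, by linarith⟩
  · dsimp only
    rw [Finset.mem_filter, sub_add_cancel, if_pos le_rfl, if_neg (by omega)]
    rintro ⟨-, h'⟩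
    linarith

/-- Termination of the inner induction: the increment attaining the minimum becomes `0`, and no new
increment is created. -/
theorem incrCount_sum_lt {q : ℤ} {a b c : ℤ → ℝ} {p t : ℤ} (hp : 1 ≤ p) (hpq : p + 1 ≤ q)
    (ht : 1 ≤ t) (htq : t ≤ q) (ha : 0 < a p - a (p - 1)) (hb : 0 < b (p + 1) - b p)
    (hc : 0 < c t - c (t - 1)) {ε : ℝ}
    (hε : ε = min (a p - a (p - 1)) (min (b (p + 1) - b p) (c t - c (t - 1)))) :
    incrCount q (fun j => a j - if p ≤ j then ε else 0) +
      incrCount q (fun j => b j - if p + 1 ≤ j then ε else 0) +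
      incrCount q (fun j => c j - if t ≤ j then ε else 0) <
      incrCount q a + incrCount q b + incrCount q c := by
  have h0 : 0 < ε := hε ▸ lt_min ha (lt_min hb hc)
  have la := incrCount_sub_le q a p h0.le
  have lb := incrCount_sub_le q b (p + 1) h0.le
  have lc := incrCount_sub_le q c t h0.le
  rcases min_choice (a p - a (p - 1)) (min (b (p + 1) - b p) (c t - c (t - 1))) with e | e
  · have := incrCount_sub_lt (q := q) (f := a) (s := p) hp (by omega) h0 (by rw [hε, e])
    omega
  rcases min_choice (b (p + 1) - b p) (c t - c (t - 1)) with e' | e'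
  · have := incrCount_sub_lt (q := q) (f := b) (s := p + 1) (by omega) hpq h0
      (by rw [hε, e, e', add_sub_cancel_right])
    omega
  · have := incrCount_sub_lt (q := q) (f := c) (s := t) ht htq h0 (by rw [hε, e, e'])
    omega

namespace IsVPath

variable {q : ℤ} {N : ℝ} {a b c : ℤ → ℝ}

/-- Removing the index `s` from a chain. -/
theorem delete (h : IsVPath 0 q N a b c) {s : ℤ} (hs : 0 < s) (hsq : s < q)
    (hb : b (s + 1) ≤ a (s - 1)) (hc : c (s + 1) ≤ a (s - 1)) :
    IsVPath 0 (q - 1) N (fun j => a (if j < s then j else j + 1))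
      (fun j => b (if j < s then j else j + 1)) (fun j => c (if j < s then j else j + 1)) := by
  have e0 : (if (0 : ℤ) < s then (0 : ℤ) else 0 + 1) = 0 := if_pos hs
  have eN : (if 0 + (q - 1) < s then 0 + (q - 1) else 0 + (q - 1) + 1) = 0 + q := by
    rw [if_neg (by omega)]; ring
  have cases : ∀ j : ℤ, j < s - 1 ∨ j = s - 1 ∨ s ≤ j := fun j => by omega
  refine ⟨?_, ?_, ?_, ?_, ?_, ?_, fun j h1 h2 => ?_, fun j h1 h2 => ?_, fun j h1 h2 => ?_,
    fun j h1 h2 => ?_, fun j h1 h2 => ?_⟩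
  · simp only [e0, h.a_zero]
  · simp only [e0, h.b_zero]
  · simp only [e0, h.c_zero]
  · simp only [eN, h.a_full]
  · simp only [eN, h.b_full]
  · simp only [eN, h.c_full]
  · exact h.a_le (by split_ifs <;> omega) (by split_ifs <;> omega) (by split_ifs <;> omega)
  · exact h.b_le_b (by split_ifs <;> omega) (by split_ifs <;> omega) (by split_ifs <;> omega)
  · exact h.c_le_c (by split_ifs <;> omega) (by split_ifs <;> omega) (by split_ifs <;> omega)
  · rcases cases j with h3 | rfl | h3
    · simp only [show j < s by omega, show j + 1 < s by omega, if_true]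
      exact h.b_le j h1 (by omega)
    · simpa using hb
    · simp only [show ¬ j < s by omega, show ¬ j + 1 < s by omega, if_false]
      exact h.b_le _ (by omega) (by omega)
  · rcases cases j with h3 | rfl | h3
    · simp only [show j < s by omega, show j + 1 < s by omega, if_true]
      exact h.c_le j h1 (by omega)
    · simpa using hc
    · simp only [show ¬ j < s by omega, show ¬ j + 1 < s by omega, if_false]
      exact h.c_le _ (by omega) (by omega)

/-- Lowering the heights of the increments at `p`, `p + 1` and `t`. -/
theorem sub (h : IsVPath 0 q N a b c) {p t : ℤ} (hp : 1 ≤ p) (hpt : p + 1 ≤ t) (htq : t ≤ q) {ε : ℝ}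
    (ha : ε ≤ a p - a (p - 1)) (hb : ε ≤ b (p + 1) - b p) (hc : ε ≤ c t - c (t - 1))
    (hca : ∀ j, p ≤ j → j + 1 < t → c (j + 1) ≤ a j - ε) :
    IsVPath 0 q (N - ε) (fun j => a j - if p ≤ j then ε else 0)
      (fun j => b j - if p + 1 ≤ j then ε else 0) (fun j => c j - if t ≤ j then ε else 0) := by
  refine ⟨?_, ?_, ?_, ?_, ?_, ?_, fun j h1 h2 => ?_, fun j h1 h2 => ?_, fun j h1 h2 => ?_,
    fun j h1 h2 => ?_, fun j h1 h2 => ?_⟩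
  · rw [if_neg (by omega), h.a_zero, sub_zero]
  · rw [if_neg (by omega), h.b_zero, sub_zero]
  · rw [if_neg (by omega), h.c_zero, sub_zero]
  · rw [if_pos (by omega), h.a_full]
  · rw [if_pos (by omega), h.b_full]
  · rw [if_pos (by omega), h.c_full]
  · have := h.a_mono j h1 h2
    rcases eq_or_ne (j + 1) p with rfl | h3
    · rw [add_sub_cancel_right] at ha
      rw [if_neg (by omega), if_pos le_rfl]
      linarith
    · split_ifs <;> first | omega | linarith
  · have := h.b_mono j h1 h2
    rcases eq_or_ne j p with rfl | h3
    · rw [if_neg (by omega), if_pos le_rfl]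
      linarith
    · split_ifs <;> first | omega | linarith
  · have := h.c_mono j h1 h2
    rcases eq_or_ne (j + 1) t with rfl | h3
    · rw [add_sub_cancel_right] at hc
      rw [if_neg (by omega), if_pos le_rfl]
      linarith
    · split_ifs <;> first | omega | linarith
  · have := h.b_le j h1 h2
    split_ifs <;> first | omega | linarith
  · have := h.c_le j h1 h2
    by_cases h3 : p ≤ j ∧ j + 1 < t
    · rw [if_neg (by omega), if_pos h3.1]
      linarith [hca j h3.1 h3.2]
    · split_ifs <;> first | omega | linarith

theorem hasGrowth_zero (hq : 0 < q) (h : IsVPath 0 q 0 a b c) : HasGrowth q 0 a b c := by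
  refine ⟨fun _ _ => 0, fun _ _ => 0, fun _ _ => 0, ⟨hq, ?_, ?_, ?_, ?_, ?_, ?_, ?_, ?_, ?_, ?_, ?_⟩,
    fun j h1 h2 => ⟨?_, ?_, ?_⟩⟩
  any_goals simp
  · exact ⟨rfl, rfl, rfl, rfl, rfl, rfl, fun _ _ _ => le_rfl, fun _ _ _ => le_rfl,
      fun _ _ _ => le_rfl, fun _ _ _ => le_rfl, fun _ _ _ => le_rfl⟩
  · exact fun i j _ _ => ⟨by simp, by simp, by simp⟩
  · exact le_antisymm (h.a_nonneg h1 (by omega)) (h.a_le_top h1 (by omega))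
  · exact le_antisymm (h.b_nonneg h1 (by omega)) (h.b_le_top h1 (by omega))
  · exact le_antisymm (h.c_nonneg h1 (by omega)) (h.c_le_top h1 (by omega))

/-- The last proper increment of `a`. -/
theorem exists_last (h : IsVPath 0 q N a b c) (hq : 0 < q) (hN : N ≠ 0) :
    ∃ p, 1 ≤ p ∧ p + 1 ≤ q ∧ a (p - 1) < N ∧ ∀ j, p ≤ j → j ≤ q → a j = N := by
  -- The chain condition gives `N = b q ≤ a (q - 1)`, so `a` is full before the last site and `p + 1
  -- ≤ q`.
  have hlast : a (q - 1) = N := by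
    refine le_antisymm (h.a_le_top (by omega) (by omega)) ?_
    have := h.b_le (q - 1) (by omega) (by omega)
    rwa [sub_add_cancel, ← zero_add q, h.b_full, zero_add] at this
  obtain ⟨p, ⟨hp0, hp⟩, hmin⟩ := Int.exists_least_of_bdd (P := fun j => 0 ≤ j ∧ a j = N)
    ⟨0, fun z hz => hz.1⟩ ⟨q - 1, by omega, hlast⟩
  have hpq : p ≤ q - 1 := hmin _ ⟨by omega, hlast⟩
  have hp1 : p ≠ 0 := fun h0 => hN (by rw [← hp, h0, h.a_zero])
  refine ⟨p, by omega, by omega, ?_, fun j h1 h2 => ?_⟩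
  · refine lt_of_le_of_ne (h.a_le_top (by omega) (by omega)) fun h1 => ?_
    have := hmin _ ⟨by omega, h1⟩
    omega
  · refine le_antisymm (h.a_le_top (by omega) (by omega)) ?_
    rw [← hp]
    exact h.a_le hp0 h1 (by omega)

/-- Entries `p` and `p + 1` of the chain coincide, so one of them is dropped. The diagram of the
shorter chain is pulled back along the map that repeats the index `p`. -/
theorem hasGrowth_of_incr_zero (h : IsVPath 0 q N a b c) {p : ℤ} (hp : 1 ≤ p) (hpq : p + 1 ≤ q)
    (ha : a (p + 1) = a p) (hb : b (p + 1) = b p) (hc : c (p + 1) = c p)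
    (ih : ∀ a b c, IsVPath 0 (q - 1) N a b c → HasGrowth (q - 1) N a b c) :
    HasGrowth q N a b c := by
  have hq : 0 < q := by omega
  have b1 := h.b_le (p - 1) (by omega) (by omega)
  have c1 := h.c_le (p - 1) (by omega) (by omega)
  rw [sub_add_cancel] at b1 c1
  obtain ⟨a', b', c', g, e⟩ := ih _ _ _ (h.delete (s := p) (by omega) (by omega) (by rwa [hb])
    (by rwa [hc]))
  beta_reduce at e
  let ι : ℤ → ℤ := fun i => i - siteCount q (p + 1) i
  have V1 : ∀ i, p + 1 - q ≤ i → i ≤ p → ι i = i := fun i h1 h2 => by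
    simp only [ι, (siteCount_spec hq (p + 1) i).1 (by omega) (by omega), sub_zero]
  have V2 : ∀ i, p + 1 ≤ i → i ≤ p + q → ι i = i - 1 := fun i h1 h2 => by
    simp only [ι, (siteCount_spec hq (p + 1) i).2.1 (by omega) (by omega)]
  refine ⟨_, _, _, g.pull (ι := ι) hq (fun i => ?_) 0 fun i h1 h2 => ?_, fun j h1 h2 => ?_⟩
  · simp only [ι, siteCount_add hq]; ring
  · rcases (by omega : i < p ∨ i = p ∨ p + 1 ≤ i) with h3 | rfl | h3
    · rw [V1 i (by omega) (by omega), V1 (i + 1) (by omega) (by omega)]; omega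
    · rw [V1 i (by omega) (by omega), V2 (i + 1) (by omega) (by omega)]; omega
    · rw [V2 i (by omega) (by omega), V2 (i + 1) (by omega) (by omega)]; omega
  · rw [V1 0 (by omega) (by omega)]
    rcases (by omega : j < p ∨ j = p ∨ j = p + 1 ∨ p + 2 ≤ j) with h3 | rfl | rfl | h3
    · have := e j h1 (by omega)
      rw [if_pos h3] at this
      rwa [V1 j (by omega) (by omega)]
    · have := e j h1 (by omega)
      rw [if_neg (by omega), ha, hb, hc] at this
      rwa [V1 j (by omega) (by omega)]
    · have := e p (by omega) (by omega)
      rw [if_neg (by omega)] at this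
      rwa [V2 (p + 1) (by omega) (by omega), add_sub_cancel_right]
    · have := e (j - 1) (by omega) (by omega)
      rw [if_neg (by omega), sub_add_cancel] at this
      rwa [V2 j (by omega) (by omega)]

/-- Only `b` moves at the sites `p + 1` and `p + 2`. Deleting the entry between them merges the two
increments into one, and `insert` splits the merged site again with `β₂` the second increment. -/
theorem hasGrowth_of_merge (h : IsVPath 0 q N a b c) {p : ℤ} (hp : 1 ≤ p) (hpq : p + 2 ≤ q)
    (ha : ∀ j, p ≤ j → j ≤ q → a j = N) (hc : c (p + 1) = c p) (hc' : c (p + 2) = c (p + 1))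
    (ih : ∀ a b c, IsVPath 0 (q - 1) N a b c → HasGrowth (q - 1) N a b c) :
    HasGrowth q N a b c := by
  have a0 := ha p le_rfl (by omega)
  have b1 := h.b_le_top (j := p + 1 + 1) (by omega) (by omega)
  have c1 := h.c_le_top (j := p + 1 + 1) (by omega) (by omega)
  have m1 := h.b_mono p (by omega) (by omega)
  have m2 := h.b_mono (p + 1) (by omega) (by omega)
  have s2 : p + 1 + 1 = p + 2 := by ring
  obtain ⟨a', b', c', g, e⟩ := ih _ _ _ (h.delete (s := p + 1) (by omega) (by omega)
    (by rwa [add_sub_cancel_right, a0]) (by rwa [add_sub_cancel_right, a0]))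
  beta_reduce at e
  obtain ⟨p1, p2, p3⟩ := e p (by omega) (by omega)
  obtain ⟨p4, p5, p6⟩ := e (p + 1) (by omega) (by omega)
  rw [if_pos (by omega)] at p1 p2 p3
  rw [if_neg (by omega), s2] at p4 p5 p6
  rw [s2] at m2
  obtain ⟨a'', b'', c'', g', e'⟩ := g.insert (p := p) (β₂ := b (p + 2) - b (p + 1)) hp (by omega)
    (by rw [p1, a0]) (by rw [p6, p3, hc', hc]) (by linarith) (by rw [p5, p2]; linarith)
  rw [sub_add_cancel] at g' e'
  refine ⟨a'', b'', c'', g', fun j h1 h2 => ?_⟩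
  obtain ⟨e1, e2, e3⟩ := e' j h1 h2
  rw [e1, e2, e3]
  rcases (by omega : j ≤ p ∨ j = p + 1 ∨ p + 2 ≤ j) with h3 | rfl | h3
  · have := e j h1 (by omega)
    rw [if_pos (by omega)] at this
    rwa [if_pos (by omega), if_neg (by omega), sub_zero]
  · rw [if_pos le_rfl, if_pos rfl, p4, p5, p6, hc', ha _ (by omega) h2, ha _ (by omega) hpq]
    exact ⟨rfl, by ring, rfl⟩
  · have := e (j - 1) (by omega) (by omega)
    rw [if_neg (by omega), sub_add_cancel] at this
    rwa [if_neg (by omega), if_neg (by omega), sub_zero]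

/-- Every chain is row `0` of a growth diagram. -/
theorem hasGrowth (hq : 0 < q) (h : IsVPath 0 q N a b c) : HasGrowth q N a b c := by
  induction q, hq.le using Int.leInduction generalizing N a b c with
  | base => omega
  | succ q' hq' ihq =>
    clear hq
    -- Inner induction for fixed length. The height `N` must vary, since splitting off weight `ε`
    -- lowers it.
    generalize hk : incrCount (q' + 1) a + incrCount (q' + 1) b + incrCount (q' + 1) c = k
    induction k using Nat.strong_induction_on generalizing N a b c with
    | _ k ihk =>
      by_cases hN : N = 0
      · subst hN
        exact h.hasGrowth_zero (by omega)
      obtain ⟨p, hp, hpq, hlt, hfull⟩ := h.exists_last (by omega) hN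
      have ihq' : ∀ a b c, IsVPath 0 (q' + 1 - 1) N a b c → HasGrowth (q' + 1 - 1) N a b c := by
        intro a b c h'
        rw [add_sub_cancel_right] at h' ⊢
        exact ihq (by omega) h'
      have ap : a p = N := hfull p le_rfl (by omega)
      have ha : 0 < a p - a (p - 1) := by linarith
      -- The case of one increment at `p + 1`, stated for arbitrary outer paths so that it serves
      -- for `b` and `c` alike.
      have key : ∀ b c, IsVPath 0 (q' + 1) N a b c →
          incrCount (q' + 1) a + incrCount (q' + 1) b + incrCount (q' + 1) c = k →
          0 < b (p + 1) - b p → c (p + 1) = c p → HasGrowth (q' + 1) N a b c := by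
        intro b c h hk hb hc
        have c1 := h.c_le (p - 1) (by omega) (by omega)
        rw [sub_add_cancel] at c1
        -- If `p + 1` were the end of the chain, then `c p = N`, contradicting `c p ≤ a (p - 1) <
        -- N`.
        have hpq' : p + 2 ≤ q' + 1 := by
          by_contra h1
          have : p + 1 = 0 + (q' + 1) := by omega
          rw [this, h.c_full] at hc
          linarith
        rcases (h.c_mono (p + 1) (by omega) (by omega)).eq_or_lt with hc' | hc'
        · rw [add_assoc] at hc'
          exact h.hasGrowth_of_merge hp hpq' hfull hc hc'.symm ihq'
        · obtain ⟨ε, hε⟩ : ∃ ε, ε = min (a p - a (p - 1))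
            (min (b (p + 1) - b p) (c (p + 2) - c (p + 2 - 1))) := ⟨_, rfl⟩
          have s1 : p + 2 - 1 = p + 1 := by ring
          have s2 : p + 1 + 1 = p + 2 := by ring
          have hc0 : 0 < c (p + 2) - c (p + 2 - 1) := by
            rw [s1, ← s2]; linarith
          have h0 : 0 < ε := hε ▸ lt_min ha (lt_min hb hc0)
          have hεa : ε ≤ a p - a (p - 1) := hε ▸ min_le_left _ _
          have hεb : ε ≤ b (p + 1) - b p := hε ▸ (min_le_right _ _).trans (min_le_left _ _)
          have hεc : ε ≤ c (p + 2) - c (p + 2 - 1) :=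
            hε ▸ (min_le_right _ _).trans (min_le_right _ _)
          have cN := h.c_le_top (j := p + 2) (by omega) (by omega)
          -- The remaining condition concerns `j = p` only: `c (p + 1) ≤ c (p + 2) - ε ≤ N - ε`.
          have h' := h.sub (t := p + 2) hp (by omega) hpq' hεa hεb hεc fun j h1 h2 => by
            obtain rfl : j = p := by omega
            rw [s1] at hεc
            linarith
          obtain ⟨a', b', c', g, e⟩ := ihk _ (hk ▸ incrCount_sum_lt hp hpq (by omega) hpq' ha hb hc0
            hε) h' rfl
          beta_reduce at e
          obtain ⟨a'', b'', c'', g', e'⟩ := g.add_tripod hp hpq'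
            (by rw [(e p (by omega) (by omega)).1, if_pos le_rfl, ap])
            (by rw [(e p (by omega) (by omega)).2.2, (e (p + 1) (by omega) (by omega)).2.2,
              if_neg (by omega), if_neg (by omega), hc]) h0.le
          rw [sub_add_cancel] at g'
          refine ⟨a'', b'', c'', g', fun j h1 h2 => ?_⟩
          obtain ⟨e1, e2, e3⟩ := e j h1 h2
          obtain ⟨e4, e5, e6⟩ := e' j h1 h2
          rw [e4, e5, e6, e1, e2, e3]
          exact ⟨by ring, by ring, by ring⟩
      rcases (h.b_mono p (by omega) (by omega)).eq_or_lt with hb | hb <;>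
        rcases (h.c_mono p (by omega) (by omega)).eq_or_lt with hc | hc
      · exact h.hasGrowth_of_incr_zero hp hpq (by rw [ap, hfull _ (by omega) hpq]) hb.symm hc.symm
          ihq'
      · exact (key c b h.swap (by omega) (by linarith) hb.symm).swap
      · exact key b c h hk (by linarith) hc.symm
      · obtain ⟨ε, hε⟩ : ∃ ε, ε = min (a p - a (p - 1))
          (min (b (p + 1) - b p) (c (p + 1) - c (p + 1 - 1))) := ⟨_, rfl⟩
        have s1 : p + 1 - 1 = p := by ring
        have hb0 : 0 < b (p + 1) - b p := by linarith
        have hc0 : 0 < c (p + 1) - c (p + 1 - 1) := by rw [s1]; linarith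
        have h0 : 0 < ε := hε ▸ lt_min ha (lt_min hb0 hc0)
        have h' := h.sub (t := p + 1) hp le_rfl hpq (hε ▸ min_le_left _ _)
          (hε ▸ (min_le_right _ _).trans (min_le_left _ _))
          (hε ▸ (min_le_right _ _).trans (min_le_right _ _)) fun j h1 h2 => by omega
        obtain ⟨a', b', c', g, e⟩ := ihk _ (hk ▸ incrCount_sum_lt hp hpq (by omega) hpq ha hb0 hc0
          hε) h' rfl
        beta_reduce at e
        obtain ⟨a'', b'', c'', g', e'⟩ := g.add_edge hp hpq h0.le
        rw [sub_add_cancel] at g'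
        refine ⟨a'', b'', c'', g', fun j h1 h2 => ?_⟩
        obtain ⟨e1, e2, e3⟩ := e j h1 h2
        obtain ⟨e4, e5, e6⟩ := e' j h1 h2
        rw [e4, e5, e6, e1, e2, e3]
        exact ⟨by ring, by ring, by ring⟩

end IsVPath

/-! ### Rowmotion as a recursion from the top of a finite poset -/

theorem HatPoset.cases {P : Type*} {motive : HatPoset P → Prop} (x : HatPoset P) (bot : motive ⊥)
    (top : motive ⊤) (coe : ∀ p, motive (toHat p)) : motive x := by
  induction x using WithBot.recBotCoe with
  | bot => exact bot
  | coe y =>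
    induction y using WithTop.recTopCoe with
    | top => exact top
    | coe p => exact coe p

theorem toHat_lt_toHat {P : Type*} [PartialOrder P] {p r : P} : toHat p < toHat r ↔ p < r :=
  WithBot.coe_lt_coe.trans WithTop.coe_lt_coe

theorem toHat_le_toHat {P : Type*} [PartialOrder P] {p r : P} : toHat p ≤ toHat r ↔ p ≤ r :=
  WithBot.coe_le_coe.trans WithTop.coe_le_coe

namespace OrderPolytope

variable {P : Type*} [PartialOrder P]

theorem ext_toHat {f g : OrderPolytope P} (h : ∀ p, f.1 (toHat p) = g.1 (toHat p)) : f = g :=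
  Subtype.ext (funext fun x => by
    induction x using HatPoset.cases with
    | bot => rw [f.2.2.1, g.2.2.1]
    | top => rw [f.2.2.2, g.2.2.2]
    | coe p => exact h p)

/-- The element of the order polytope with given values on `P`. -/
def ofValues (v : P → ℝ) (hv : Monotone v) (h0 : ∀ p, 0 ≤ v p) (h1 : ∀ p, v p ≤ 1) :
    OrderPolytope P :=
  ⟨fun x => WithBot.recBotCoe 0 (fun y => WithTop.recTopCoe 1 v y) x, by
    intro x y h
    induction x using HatPoset.cases with
    | bot =>
      induction y using HatPoset.cases with
      | bot => exact le_rfl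
      | top => exact zero_le_one
      | coe r => exact h0 r
    | top => rw [top_le_iff.1 h]
    | coe p =>
      induction y using HatPoset.cases with
      | bot => exact absurd (bot_lt_toHat p) h.not_gt
      | top => exact h1 p
      | coe r => exact hv (toHat_le_toHat.1 h), rfl, rfl⟩

theorem minAbove_congr {f g : HatPoset P → ℝ} {p : P} (h : ∀ r, toHat p < r → f r = g r) :
    minAbove f p = minAbove g p := by
  unfold minAbove
  rw [Set.image_congr (g := g)]
  exact fun r hr => h r (CovBy.lt hr)

theorem maxBelow_congr {f g : HatPoset P → ℝ} {p : P} (h : ∀ r, r < toHat p → f r = g r) :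
    maxBelow f p = maxBelow g p := by
  unfold maxBelow
  rw [Set.image_congr (g := g)]
  exact fun r hr => h r (CovBy.lt hr)

variable [Finite P]

/-- For monotone `f` the minimum over covers is the minimum over all elements strictly above, so
covers need not be determined. -/
theorem minAbove_eq {f : HatPoset P → ℝ} (hf : Monotone f) {p : P} {m : ℝ}
    (h : ∀ r, toHat p < r → m ≤ f r) (h' : ∃ r, toHat p < r ∧ f r = m) : minAbove f p = m := by
  obtain ⟨r, hr, rfl⟩ := h'
  refine le_antisymm (minAbove_le hf p hr) ?_
  obtain ⟨s, hs, -⟩ := exists_covBy_le_of_lt (toHat_lt_top p)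
  refine le_csInf ⟨f s, s, hs, rfl⟩ ?_
  rintro _ ⟨s, hs, rfl⟩
  exact h s (CovBy.lt hs)

theorem maxBelow_eq {f : HatPoset P → ℝ} (hf : Monotone f) {p : P} {m : ℝ}
    (h : ∀ r, r < toHat p → f r ≤ m) (h' : ∃ r, r < toHat p ∧ f r = m) : maxBelow f p = m := by
  obtain ⟨r, hr, rfl⟩ := h'
  refine le_antisymm ?_ (le_maxBelow hf p hr)
  obtain ⟨s, -, hs⟩ := exists_le_covBy_of_lt (bot_lt_toHat p)
  refine csSup_le ⟨f s, s, hs, rfl⟩ ?_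
  rintro _ ⟨s, hs, rfl⟩
  exact h s (CovBy.lt hs)

open Classical in
-- The recursion for `g` records what a toggle sees: new values above, old values below. The
-- rightmost toggle acts first, so when the head `s` is toggled, everything above `s` lies in the
-- tail and has its new value, while nothing below `s` has changed.
theorem prod_toggle_apply {f g : OrderPolytope P}
    (h : ∀ p, g.1 (toHat p) = minAbove g.1 p + maxBelow f.1 p - f.1 (toHat p)) (l : List P)
    (hl : l.Pairwise fun p r => ¬ r ≤ p) (hup : ∀ p ∈ l, ∀ r, p < r → r ∈ l) (p : P) :
    ((l.map toggle).prod f).1 (toHat p) = if p ∈ l then g.1 (toHat p) else f.1 (toHat p) := by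
  induction l generalizing p with
  | nil => simp
  | cons s l ih =>
    rw [List.pairwise_cons] at hl
    have ih := ih hl.2 fun p hp r hr => by
      rcases List.mem_cons.1 (hup p (List.mem_cons_of_mem _ hp) r hr) with rfl | h
      · exact absurd hr.le (hl.1 p hp)
      · exact h
    have hs : s ∉ l := fun hs => hl.1 s hs le_rfl
    rw [List.map_cons, List.prod_cons]
    set F := (l.map toggle).prod f
    change toggleFun s F.1 (toHat p) = _
    by_cases hp : p = s
    · subst hp
      rw [toggleFun_self, if_pos List.mem_cons_self, h, ih, if_neg hs]
      congr 2
      · refine minAbove_congr fun r hr => ?_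
        induction r using HatPoset.cases with
        | bot => exact absurd (bot_lt_toHat p) hr.not_gt
        | top => rw [F.2.2.2, g.2.2.2]
        | coe r =>
          rw [toHat_lt_toHat] at hr
          rcases List.mem_cons.1 (hup p List.mem_cons_self r hr) with rfl | hr'
          · exact absurd hr (lt_irrefl _)
          · rw [ih, if_pos hr']
      · refine maxBelow_congr fun r hr => ?_
        induction r using HatPoset.cases with
        | bot => rw [F.2.2.1, f.2.2.1]
        | top => exact absurd (toHat_lt_top p) hr.not_gt
        | coe r =>
          rw [toHat_lt_toHat] at hr
          rw [ih, if_neg fun hr' => hl.1 r hr' hr.le]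
    · have hp' : toHat p ≠ toHat s := fun e =>
        hp (WithTop.coe_injective (WithBot.coe_injective e))
      rw [toggleFun_of_ne s F.1 hp', ih]
      simp [hp]

/-- Rowmotion is determined by its recursion from the top of the poset. -/
theorem rowmotion_eq {L : P ≃ Fin (Nat.card P)} (hL : Monotone L) {f g : OrderPolytope P}
    (h : ∀ p, g.1 (toHat p) = minAbove g.1 p + maxBelow f.1 p - f.1 (toHat p)) :
    rowmotion L f = g := by
  classical
  have e : rowmotion L = ((List.ofFn L.symm).map toggle).prod := by
    rw [List.map_ofFn]; rfl
  have mem : ∀ p, p ∈ List.ofFn L.symm := fun p => by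
    rw [List.mem_ofFn]
    exact ⟨L p, L.symm_apply_apply p⟩
  refine ext_toHat fun p => ?_
  rw [e, prod_toggle_apply h, if_pos (mem p)]
  · rw [List.pairwise_ofFn]
    intro i j hij hle
    have := hL hle
    simp only [Equiv.apply_symm_apply] at this
    exact absurd hij this.not_gt
  · exact fun _ _ r _ => mem r

end OrderPolytope

/-! ### Points of the order polytope as triples of fibers -/

/-- The three fibers, from bottom to top, of a point of the order polytope of `V × [k]`, including
the values `0` and `1` of the adjoined elements at `0` and `k + 1`. -/
structure IsLadder (k : ℤ) (α β γ : ℤ → ℝ) : Prop where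
  α_zero : α 0 = 0
  β_zero : β 0 = 0
  γ_zero : γ 0 = 0
  α_one : α (k + 1) = 1
  β_one : β (k + 1) = 1
  γ_one : γ (k + 1) = 1
  α_mono : ∀ m, 0 ≤ m → m ≤ k → α m ≤ α (m + 1)
  β_mono : ∀ m, 0 ≤ m → m ≤ k → β m ≤ β (m + 1)
  γ_mono : ∀ m, 0 ≤ m → m ≤ k → γ m ≤ γ (m + 1)
  α_le_β : ∀ m, 1 ≤ m → m ≤ k → α m ≤ β m
  α_le_γ : ∀ m, 1 ≤ m → m ≤ k → α m ≤ γ m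

theorem Int.le_of_forall_le_succ {f : ℤ → ℝ} {s t : ℤ} (h : ∀ m, s ≤ m → m < t → f m ≤ f (m + 1))
    {m n : ℤ} (hm : s ≤ m) (hmn : m ≤ n) (hn : n ≤ t) : f m ≤ f n := by
  induction n, hmn using Int.leInduction with
  | base => exact le_rfl
  | succ n hmn ih => exact (ih (by omega)).trans (h n (by omega) (by omega))

theorem VPoset.le_iff {x y : VPoset} : x ≤ y ↔ x = y ∨ x = .A := Iff.rfl

namespace IsLadder

variable {k : ℕ} {α β γ : ℤ → ℝ}

theorem α_le (h : IsLadder k α β γ) {m n : ℤ} (hm : 0 ≤ m) (hmn : m ≤ n) (hn : n ≤ k + 1) :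
    α m ≤ α n :=
  Int.le_of_forall_le_succ (fun m h1 h2 => h.α_mono m h1 (by omega)) hm hmn hn

theorem β_le (h : IsLadder k α β γ) {m n : ℤ} (hm : 0 ≤ m) (hmn : m ≤ n) (hn : n ≤ k + 1) :
    β m ≤ β n :=
  Int.le_of_forall_le_succ (fun m h1 h2 => h.β_mono m h1 (by omega)) hm hmn hn

theorem γ_le (h : IsLadder k α β γ) {m n : ℤ} (hm : 0 ≤ m) (hmn : m ≤ n) (hn : n ≤ k + 1) :
    γ m ≤ γ n :=
  Int.le_of_forall_le_succ (fun m h1 h2 => h.γ_mono m h1 (by omega)) hm hmn hn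

theorem swap (h : IsLadder k α β γ) : IsLadder k α γ β :=
  ⟨h.α_zero, h.γ_zero, h.β_zero, h.α_one, h.γ_one, h.β_one, h.α_mono, h.γ_mono, h.β_mono, h.α_le_γ,
    h.α_le_β⟩

end IsLadder

/-- The fiber over an element of `V`. -/
def VPoset.fiber (α β γ : ℤ → ℝ) : VPoset → ℤ → ℝ
  | .A => α
  | .B => β
  | .C => γ

namespace IsLadder

variable {k : ℕ} {α β γ α' β' γ' : ℤ → ℝ}

theorem fiber_zero (h : IsLadder k α β γ) (x : VPoset) : x.fiber α β γ 0 = 0 := by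
  rcases x with _ | _ | _
  exacts [h.α_zero, h.β_zero, h.γ_zero]

theorem fiber_one (h : IsLadder k α β γ) (x : VPoset) : x.fiber α β γ (k + 1) = 1 := by
  rcases x with _ | _ | _
  exacts [h.α_one, h.β_one, h.γ_one]

theorem fiber_le (h : IsLadder k α β γ) (x : VPoset) {m n : ℤ} (hm : 0 ≤ m) (hmn : m ≤ n)
    (hn : n ≤ k + 1) : x.fiber α β γ m ≤ x.fiber α β γ n := by
  refine Int.le_of_forall_le_succ (fun m h1 h2 => ?_) hm hmn hn
  rcases x with _ | _ | _
  exacts [h.α_mono m h1 (by omega), h.β_mono m h1 (by omega), h.γ_mono m h1 (by omega)]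

theorem le_fiber (h : IsLadder k α β γ) (x : VPoset) {m : ℤ} (hm : 1 ≤ m) (hmk : m ≤ k) :
    α m ≤ x.fiber α β γ m := by
  rcases x with _ | _ | _
  exacts [le_rfl, h.α_le_β m hm hmk, h.α_le_γ m hm hmk]

theorem fiber_mono (h : IsLadder k α β γ) {x y : VPoset} (hxy : x ≤ y) {m n : ℤ} (hm : 1 ≤ m)
    (hmn : m ≤ n) (hn : n ≤ k) : x.fiber α β γ m ≤ y.fiber α β γ n := by
  rcases VPoset.le_iff.1 hxy with rfl | rfl
  · exact h.fiber_le x (by omega) hmn (by omega)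
  · exact (h.le_fiber y hm (by omega)).trans (h.fiber_le y (by omega) hmn (by omega))

/-- The point of the order polytope with the given fibers. -/
def toPolytope (h : IsLadder k α β γ) : OrderPolytope (VPoset × Fin k) :=
  OrderPolytope.ofValues (fun p => p.1.fiber α β γ (p.2 + 1))
    (fun p r hpr => by
      have h2 : (p.2 : ℕ) ≤ r.2 := hpr.2
      have := r.2.2
      exact h.fiber_mono hpr.1 (by omega) (by omega) (by omega))
    (fun p => (h.fiber_zero p.1).symm.trans_le (h.fiber_le p.1 le_rfl (by omega) (by omega)))
    (fun p => (h.fiber_le p.1 (by omega) (by omega) le_rfl).trans_eq (h.fiber_one p.1))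

theorem toPolytope_toHat (h : IsLadder k α β γ) (x : VPoset) (m : Fin k) :
    h.toPolytope.1 (toHat (x, m)) = x.fiber α β γ (m + 1) := rfl

theorem toPolytope_congr (h : IsLadder k α β γ) (h' : IsLadder k α' β' γ')
    (e : ∀ x, ∀ m, 1 ≤ m → m ≤ (k : ℤ) → VPoset.fiber α β γ x m = VPoset.fiber α' β' γ' x m) :
    h.toPolytope = h'.toPolytope :=
  OrderPolytope.ext_toHat fun p => e p.1 _ (by omega) (by omega)

/-- The element `m : Fin k` sits at height `m + 1`, so `m + 2` is the next height. At the top of the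
fiber its role is played by `⊤`, whose value is the boundary value at `k + 1`. -/
theorem exists_gt (h : IsLadder k α β γ) (x : VPoset) (m : Fin k) :
    ∃ r, toHat (x, m) < r ∧ h.toPolytope.1 r = x.fiber α β γ (m + 2) := by
  by_cases hm : (m : ℕ) + 1 < k
  · refine ⟨toHat (x, ⟨m + 1, hm⟩), ?_, ?_⟩
    · rw [toHat_lt_toHat, Prod.mk_lt_mk_iff_right, Fin.lt_def]
      exact Nat.lt_succ_self _
    · rw [toPolytope_toHat]
      push_cast
      ring_nf
  · refine ⟨⊤, OrderPolytope.toHat_lt_top _, ?_⟩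
    rw [h.toPolytope.2.2.2, show (m : ℤ) + 2 = k + 1 by have := m.2; omega, h.fiber_one]

theorem exists_lt (h : IsLadder k α β γ) (x : VPoset) (m : Fin k) :
    ∃ r, r < toHat (x, m) ∧ h.toPolytope.1 r = x.fiber α β γ m := by
  by_cases hm : 0 < (m : ℕ)
  · refine ⟨toHat (x, ⟨m - 1, by omega⟩), ?_, ?_⟩
    · rw [toHat_lt_toHat, Prod.mk_lt_mk_iff_right, Fin.lt_def]
      exact Nat.sub_lt hm one_pos
    · rw [toPolytope_toHat]
      push_cast [show 1 ≤ (m : ℕ) from hm]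
      ring_nf
  · refine ⟨⊥, OrderPolytope.bot_lt_toHat _, ?_⟩
    rw [h.toPolytope.2.2.1, show (m : ℤ) = 0 by omega, h.fiber_zero]

theorem _root_.VPoset.A_lt {x : VPoset} (hx : x ≠ .A) : VPoset.A < x :=
  lt_of_le_of_ne (VPoset.le_iff.2 (Or.inr rfl)) hx.symm

theorem minAbove_A (h : IsLadder k α β γ) (m : Fin k) :
    OrderPolytope.minAbove h.toPolytope.1 (.A, m) =
      min (α (m + 2)) (min (β (m + 1)) (γ (m + 1))) := by
  refine OrderPolytope.minAbove_eq h.toPolytope.2.1 (fun r hr => ?_) ?_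
  · induction r using HatPoset.cases with
    | bot => exact absurd (OrderPolytope.bot_lt_toHat _) hr.not_gt
    | top =>
      rw [h.toPolytope.2.2.2, ← h.α_one]
      exact (min_le_left _ _).trans (h.α_le (by omega) (by omega) le_rfl)
    | coe p =>
      obtain ⟨x, i⟩ := p
      rw [toHat_lt_toHat] at hr
      have hi : (m : ℕ) ≤ i := hr.le.2
      rw [toPolytope_toHat]
      rcases x with _ | _ | _
      · rw [Prod.mk_lt_mk_iff_right, Fin.lt_def] at hr
        exact (min_le_left _ _).trans (h.α_le (by omega) (by omega) (by omega))
      · exact (min_le_right _ _).trans ((min_le_left _ _).trans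
          (h.β_le (by omega) (by omega) (by omega)))
      · exact (min_le_right _ _).trans ((min_le_right _ _).trans
          (h.γ_le (by omega) (by omega) (by omega)))
  · have lt : ∀ x : VPoset, x ≠ .A → toHat (VPoset.A, m) < toHat (x, m) := fun x hx => by
      rw [toHat_lt_toHat, Prod.mk_lt_mk_iff_left]
      exact VPoset.A_lt hx
    rcases min_choice (α (m + 2)) (min (β (m + 1)) (γ (m + 1))) with e | e <;> rw [e]
    · exact h.exists_gt .A m
    · rcases min_choice (β (m + 1)) (γ (m + 1)) with e | e <;> rw [e]
      · exact ⟨toHat (.B, m), lt .B (by rintro ⟨⟩), rfl⟩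
      · exact ⟨toHat (.C, m), lt .C (by rintro ⟨⟩), rfl⟩

theorem maxBelow_A (h : IsLadder k α β γ) (m : Fin k) :
    OrderPolytope.maxBelow h.toPolytope.1 (.A, m) = α m := by
  refine OrderPolytope.maxBelow_eq h.toPolytope.2.1 (fun r hr => ?_) (h.exists_lt .A m)
  induction r using HatPoset.cases with
  | bot =>
    rw [h.toPolytope.2.2.1, ← h.α_zero]
    exact h.α_le le_rfl (by omega) (by omega)
  | top => exact absurd (OrderPolytope.toHat_lt_top _) hr.not_gt
  | coe p =>
    obtain ⟨x, i⟩ := p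
    rw [toHat_lt_toHat] at hr
    obtain rfl : x = .A := by
      rcases VPoset.le_iff.1 hr.le.1 with e | e <;> exact e
    rw [Prod.mk_lt_mk_iff_right, Fin.lt_def] at hr
    rw [toPolytope_toHat]
    exact h.α_le (by omega) (by omega) (by omega)

theorem minAbove_of_ne (h : IsLadder k α β γ) {x : VPoset} (hx : x ≠ .A) (m : Fin k) :
    OrderPolytope.minAbove h.toPolytope.1 (x, m) = x.fiber α β γ (m + 2) := by
  refine OrderPolytope.minAbove_eq h.toPolytope.2.1 (fun r hr => ?_) (h.exists_gt x m)
  induction r using HatPoset.cases with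
  | bot => exact absurd (OrderPolytope.bot_lt_toHat _) hr.not_gt
  | top =>
    rw [h.toPolytope.2.2.2, ← h.fiber_one x]
    exact h.fiber_le x (by omega) (by omega) le_rfl
  | coe p =>
    obtain ⟨y, i⟩ := p
    rw [toHat_lt_toHat] at hr
    obtain rfl : x = y := (VPoset.le_iff.1 hr.le.1).resolve_right hx
    rw [Prod.mk_lt_mk_iff_right, Fin.lt_def] at hr
    rw [toPolytope_toHat]
    exact h.fiber_le x (by omega) (by omega) (by omega)

theorem maxBelow_of_ne (h : IsLadder k α β γ) {x : VPoset} (hx : x ≠ .A) (m : Fin k) :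
    OrderPolytope.maxBelow h.toPolytope.1 (x, m) = max (α (m + 1)) (x.fiber α β γ m) := by
  refine OrderPolytope.maxBelow_eq h.toPolytope.2.1 (fun r hr => ?_) ?_
  · induction r using HatPoset.cases with
    | bot =>
      rw [h.toPolytope.2.2.1, ← h.fiber_zero x]
      exact (h.fiber_le x le_rfl (by omega) (by omega)).trans (le_max_right _ _)
    | top => exact absurd (OrderPolytope.toHat_lt_top _) hr.not_gt
    | coe p =>
      obtain ⟨y, i⟩ := p
      rw [toHat_lt_toHat] at hr
      have hi : (i : ℕ) ≤ m := hr.le.2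
      rw [toPolytope_toHat]
      rcases VPoset.le_iff.1 hr.le.1 with e | e
      · obtain rfl : y = x := e
        rw [Prod.mk_lt_mk_iff_right, Fin.lt_def] at hr
        exact (h.fiber_le y (by omega) (by omega) (by omega)).trans (le_max_right _ _)
      · obtain rfl : y = .A := e
        exact (h.α_le (by omega) (by omega) (by omega)).trans (le_max_left _ _)
  · rcases max_choice (α (m + 1)) (x.fiber α β γ m) with e | e <;> rw [e]
    · refine ⟨toHat (.A, m), ?_, rfl⟩
      rw [toHat_lt_toHat, Prod.mk_lt_mk_iff_left]
      exact VPoset.A_lt hx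
    · exact h.exists_lt x m

/-- The recursion for rowmotion on `V × [k]`. -/
theorem rowmotion_eq (h : IsLadder k α β γ) (h' : IsLadder k α' β' γ')
    (hα : ∀ m, 1 ≤ m → m ≤ (k : ℤ) →
      α' m = min (α' (m + 1)) (min (β' m) (γ' m)) + α (m - 1) - α m)
    (hβ : ∀ m, 1 ≤ m → m ≤ (k : ℤ) → β' m = β' (m + 1) + max (α m) (β (m - 1)) - β m)
    (hγ : ∀ m, 1 ≤ m → m ≤ (k : ℤ) → γ' m = γ' (m + 1) + max (α m) (γ (m - 1)) - γ m)
    {L : VPoset × Fin k ≃ Fin (Nat.card (VPoset × Fin k))} (hL : Monotone L) :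
    OrderPolytope.rowmotion L h.toPolytope = h'.toPolytope := by
  refine OrderPolytope.rowmotion_eq hL fun p => ?_
  obtain ⟨x, m⟩ := p
  have hm := m.2
  have e : (m : ℤ) + 2 = m + 1 + 1 := by ring
  rw [toPolytope_toHat, toPolytope_toHat]
  rcases x with _ | _ | _
  · rw [minAbove_A, maxBelow_A, e]
    have := hα (m + 1) (by omega) (by omega)
    rwa [add_sub_cancel_right] at this
  · rw [minAbove_of_ne _ (by rintro ⟨⟩), maxBelow_of_ne _ (by rintro ⟨⟩), e]
    have := hβ (m + 1) (by omega) (by omega)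
    rwa [add_sub_cancel_right] at this
  · rw [minAbove_of_ne _ (by rintro ⟨⟩), maxBelow_of_ne _ (by rintro ⟨⟩), e]
    have := hγ (m + 1) (by omega) (by omega)
    rwa [add_sub_cancel_right] at this

/-- The reflection exchanges the outer fibers. -/
theorem flip_toPolytope (h : IsLadder k α β γ) :
    orderPolytopeFlip k h.toPolytope = h.swap.toPolytope :=
  OrderPolytope.ext_toHat fun p => by
    obtain ⟨_ | _ | _, m⟩ := p <;> rfl

end IsLadder

/-! ### Passing to the next row is rowmotion -/

namespace IsGrowth

variable {q : ℤ} {N : ℝ} {k : ℕ} {a b c : ℤ → ℤ → ℝ}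

theorem a_pred (h : IsGrowth q N a b c) (i : ℤ) : a i (i + q - 1) = N := by
  have hq := h.q_pos
  refine le_antisymm ((h.path i).a_le_top (by omega) (by omega)) ?_
  have := (h.path i).b_le (i + q - 1) (by omega) (by omega)
  rwa [sub_add_cancel, h.b_full] at this

/-- The rows of a growth diagram, read as points of the order polytope. -/
theorem ladder (h : IsGrowth (k + 2) 1 a b c) (i : ℤ) :
    IsLadder k (fun m => 1 - a (i + 1) (i + (k + 2) - m)) (fun m => 1 - b i (i + (k + 2) - m))
      (fun m => 1 - c i (i + (k + 2) - m)) := by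
  have s0 : ∀ m : ℤ, i + (k + 2) - m = i + (k + 2) - (m + 1) + 1 := fun m => by ring
  have s1 : i + (k + 2) - ((k : ℤ) + 1) = i + 1 := by ring
  refine ⟨?_, ?_, ?_, ?_, ?_, ?_, fun m h1 h2 => ?_, fun m h1 h2 => ?_, fun m h1 h2 => ?_,
    fun m h1 h2 => ?_, fun m h1 h2 => ?_⟩
  · rw [sub_zero, show i + ((k : ℤ) + 2) = i + 1 + (k + 2) - 1 by ring, h.a_pred, sub_self]
  · rw [sub_zero, h.b_full, sub_self]
  · rw [sub_zero, h.c_full, sub_self]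
  · rw [s1, h.a_zero, sub_zero]
  · rw [s1, h.b_succ, sub_zero]
  · rw [s1, h.c_succ, sub_zero]
  · rw [s0]
    exact sub_le_sub_left ((h.path _).a_mono _ (by omega) (by omega)) _
  · rw [s0]
    exact sub_le_sub_left ((h.path _).b_mono _ (by omega) (by omega)) _
  · rw [s0]
    exact sub_le_sub_left ((h.path _).c_mono _ (by omega) (by omega)) _
  -- Reading the `A`-fiber one row later than the outer fibers turns interlacing of rows into the
  -- order relation between fibers.
  · exact sub_le_sub_left (h.b_le_a_succ (by omega) (by omega)) _
  · exact sub_le_sub_left (h.c_le_a_succ (by omega) (by omega)) _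

/-- Complementing to `1` exchanges maxima and minima, so the local rule becomes the toggle
recursion: `rule_a` on row `i + 1`, `rule_b` and `rule_c` on row `i`, at column `i + (k + 2) - m`
for height `m`. -/
theorem rowmotion_ladder (h : IsGrowth (k + 2) 1 a b c) (i : ℤ)
    {L : VPoset × Fin k ≃ Fin (Nat.card (VPoset × Fin k))} (hL : Monotone L) :
    OrderPolytope.rowmotion L (h.ladder i).toPolytope = (h.ladder (i + 1)).toPolytope := by
  have min_sub : ∀ x y : ℝ, min (1 - x) (1 - y) = 1 - max x y := fun x y => min_sub_sub_left 1 x y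
  have max_sub : ∀ x y : ℝ, max (1 - x) (1 - y) = 1 - min x y := fun x y => max_sub_sub_left 1 x y
  have s1 : ∀ m : ℤ, i + 1 + (k + 2) - m = i + (k + 2) - m + 1 := fun m => by ring
  have s2 : ∀ m : ℤ, i + (k + 2) - (m + 1) + 1 = i + (k + 2) - m := fun m => by ring
  have s3 : ∀ m : ℤ, i + (k + 2) - (m - 1) = i + (k + 2) - m + 1 := fun m => by ring
  refine (h.ladder i).rowmotion_eq (h.ladder (i + 1)) (fun m h1 h2 => ?_) (fun m h1 h2 => ?_)
    (fun m h1 h2 => ?_) hL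
  · have r := (h.rule (i + 1) (i + (k + 2) - m) (by omega) (by omega)).rule_a
    rw [min_sub, min_sub, s1, s1, s2, s3]
    linarith
  · have r := (h.rule i (i + (k + 2) - m) (by omega) (by omega)).rule_b
    rw [max_sub, s1, s1, s2, s3, min_comm]
    linarith
  · have r := (h.rule i (i + (k + 2) - m) (by omega) (by omega)).rule_c
    rw [max_sub, s1, s1, s2, s3, min_comm]
    linarith

theorem rowmotion_pow_ladder (h : IsGrowth (k + 2) 1 a b c)
    {L : VPoset × Fin k ≃ Fin (Nat.card (VPoset × Fin k))} (hL : Monotone L) (n : ℕ) :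
    (OrderPolytope.rowmotion L ^ n) (h.ladder 0).toPolytope = (h.ladder n).toPolytope := by
  induction n with
  | zero => rfl
  | succ n ih =>
    rw [pow_succ', Equiv.Perm.mul_apply, ih, h.rowmotion_ladder _ hL, Nat.cast_succ]

theorem flip_ladder (h : IsGrowth (k + 2) 1 a b c) :
    orderPolytopeFlip k (h.ladder 0).toPolytope = (h.ladder (k + 2)).toPolytope := by
  rw [IsLadder.flip_toPolytope]
  have s1 : ∀ m : ℤ, (k : ℤ) + 2 + (k + 2) - m = 0 + (k + 2) - m + (k + 2) := fun m => by ring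
  have s2 : (k : ℤ) + 2 + 1 = 0 + 1 + (k + 2) := by ring
  have b_flip : ∀ j, b (k + 2) (j + (k + 2)) = c 0 j := fun j => by
    have := h.b_flip 0 j
    rwa [zero_add] at this
  have c_flip : ∀ j, c (k + 2) (j + (k + 2)) = b 0 j := fun j => by
    have := h.c_flip 0 j
    rwa [zero_add] at this
  refine IsLadder.toPolytope_congr _ _ fun x m h1 h2 => ?_
  rcases x with _ | _ | _ <;> dsimp only [VPoset.fiber] <;> rw [s1]
  · rw [s2, h.a_flip]
  · rw [b_flip]
  · rw [c_flip]

end IsGrowth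

/-! ### Every point of the order polytope is a row -/

namespace IsLadder

variable {k : ℕ} {α β γ : ℤ → ℝ}

/-- Every point of the order polytope is given by its fibers. -/
theorem exists_toPolytope (f : OrderPolytope (VPoset × Fin k)) :
    ∃ α β γ, ∃ h : IsLadder k α β γ, h.toPolytope = f := by
  let v : VPoset → ℤ → ℝ := fun x m =>
    if hm : 1 ≤ m ∧ m ≤ k then f.1 (toHat (x, ⟨(m - 1).toNat, by omega⟩)) else if m ≤ 0 then 0 else 1
  have v0 : ∀ x, v x 0 = 0 := fun x => by simp [v]
  have v1 : ∀ x, v x (k + 1) = 1 := fun x => by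
    simp only [v]
    rw [dif_neg (by omega), if_neg (by omega)]
  have v_eq : ∀ x m (h1 : 1 ≤ m) (h2 : m ≤ (k : ℤ)),
      v x m = f.1 (toHat (x, ⟨(m - 1).toNat, by omega⟩)) := fun x m h1 h2 => dif_pos ⟨h1, h2⟩
  have mono : ∀ x m, 0 ≤ m → m ≤ (k : ℤ) → v x m ≤ v x (m + 1) := fun x m h1 h2 => by
    rcases h1.eq_or_lt with rfl | h1
    · rw [v0]
      rcases h2.eq_or_lt with h2 | h2
      · rw [h2, v1]
        exact zero_le_one
      · rw [v_eq x _ (by omega) (by omega)]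
        exact f.2.2.1.symm.trans_le (f.2.1 bot_le)
    · rw [v_eq x m h1 h2]
      rcases h2.eq_or_lt with rfl | h2
      · rw [v1]
        exact (f.2.1 le_top).trans_eq f.2.2.2
      · rw [v_eq x _ (by omega) (by omega)]
        refine f.2.1 (toHat_le_toHat.2 (Prod.mk_le_mk.2 ⟨le_rfl, Fin.le_def.2 ?_⟩))
        dsimp only
        omega
  have le : ∀ x m, 1 ≤ m → m ≤ (k : ℤ) → v .A m ≤ v x m := fun x m h1 h2 => by
    rw [v_eq _ m h1 h2, v_eq _ m h1 h2]
    exact f.2.1 (toHat_le_toHat.2 (Prod.mk_le_mk.2 ⟨VPoset.le_iff.2 (Or.inr rfl), le_rfl⟩))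
  refine ⟨v .A, v .B, v .C, ⟨v0 _, v0 _, v0 _, v1 _, v1 _, v1 _, mono _, mono _, mono _, le _, le _⟩,
    OrderPolytope.ext_toHat fun p => ?_⟩
  obtain ⟨x, m⟩ := p
  have hm := m.2
  rw [toPolytope_toHat]
  have e : VPoset.fiber (v .A) (v .B) (v .C) x = v x := by rcases x with _ | _ | _ <;> rfl
  rw [e, v_eq x _ (by omega) (by omega)]
  exact congrArg (fun i => f.1 (toHat (x, i))) (Fin.ext (by simp))

/-- Every point of the order polytope is a row of a growth diagram. -/
theorem exists_growth (h : IsLadder k α β γ) :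
    ∃ a b c, ∃ g : IsGrowth (k + 2) 1 a b c, (g.ladder 0).toPolytope = h.toPolytope := by
  let a₁ : ℤ → ℝ := fun j => 1 - α (k + 2 - j)
  let b₀ : ℤ → ℝ := fun j => 1 - β (k + 2 - j)
  let c₀ : ℤ → ℝ := fun j => 1 - γ (k + 2 - j)
  let M : ℤ → ℝ := fun j => max (a₁ j) (max (b₀ (j + 1)) (c₀ (j + 1)))
  -- The `A`-fiber prescribes row `1` of `a`. Row `0` is recovered by solving `rule_a` leftwards
  -- from the value `1` at column `k + 1`, with `e n` the entry at `k + 1 - n`. Truncation by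
  -- `toNat` also gives the value `1` at column `k + 2`.
  let e : ℕ → ℝ := fun n => Nat.rec 1 (fun n x => x + M (k - n) - a₁ (k - n + 1)) n
  let a₀ : ℤ → ℝ := fun j => if j ≤ 0 then 0 else e (k + 1 - j).toNat
  have a₀_one : a₀ (k + 1) = 1 := by
    simp only [a₀]
    rw [if_neg (by omega), sub_self]
    rfl
  have a₀_two : a₀ (k + 2) = 1 := by
    simp only [a₀]
    rw [if_neg (by omega), show (k : ℤ) + 1 - (k + 2) = -1 by ring]
    rfl
  have a₀_rec : ∀ j, 1 ≤ j → j ≤ (k : ℤ) → a₀ j = a₀ (j + 1) + M j - a₁ (j + 1) := fun j h1 h2 => by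
    simp only [a₀]
    rw [if_neg (by omega), if_neg (by omega),
      show (k + 1 - j).toNat = (k + 1 - (j + 1)).toNat + 1 by omega]
    have hj : (k : ℤ) - ((k + 1 - (j + 1)).toNat : ℤ) = j := by omega
    change e _ + M _ - a₁ _ = _
    rw [hj]
  have a₁_one : a₁ 1 = 0 := by
    simp only [a₁]
    rw [show (k : ℤ) + 2 - 1 = k + 1 by ring, h.α_one, sub_self]
  have b₀_one : b₀ 1 = 0 := by
    simp only [b₀]
    rw [show (k : ℤ) + 2 - 1 = k + 1 by ring, h.β_one, sub_self]
  have c₀_one : c₀ 1 = 0 := by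
    simp only [c₀]
    rw [show (k : ℤ) + 2 - 1 = k + 1 by ring, h.γ_one, sub_self]
  have b₀_full : b₀ (k + 2) = 1 := by
    simp only [b₀]
    rw [sub_self, h.β_zero, sub_zero]
  have c₀_full : c₀ (k + 2) = 1 := by
    simp only [c₀]
    rw [sub_self, h.γ_zero, sub_zero]
  have a₁_mono : ∀ j, 1 ≤ j → j ≤ (k : ℤ) + 1 → a₁ j ≤ a₁ (j + 1) := fun j h1 h2 =>
    sub_le_sub_left (h.α_le (by omega) (by omega) (by omega)) _
  have b₀_mono : ∀ j, 1 ≤ j → j ≤ (k : ℤ) + 1 → b₀ j ≤ b₀ (j + 1) := fun j h1 h2 =>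
    sub_le_sub_left (h.β_le (by omega) (by omega) (by omega)) _
  have c₀_mono : ∀ j, 1 ≤ j → j ≤ (k : ℤ) + 1 → c₀ j ≤ c₀ (j + 1) := fun j h1 h2 =>
    sub_le_sub_left (h.γ_le (by omega) (by omega) (by omega)) _
  have b₀_le : ∀ j, 2 ≤ j → j ≤ (k : ℤ) + 1 → b₀ j ≤ a₁ j := fun j h1 h2 =>
    sub_le_sub_left (h.α_le_β _ (by omega) (by omega)) _
  have c₀_le : ∀ j, 2 ≤ j → j ≤ (k : ℤ) + 1 → c₀ j ≤ a₁ j := fun j h1 h2 =>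
    sub_le_sub_left (h.α_le_γ _ (by omega) (by omega)) _
  have a₁_le : ∀ j, 1 ≤ j → j ≤ (k : ℤ) + 1 → a₁ j ≤ a₀ j := fun j h1 h2 => by
    induction j, h2 using Int.leInductionDown with
    | base =>
      rw [a₀_one]
      simp only [a₁]
      rw [show (k : ℤ) + 2 - (k + 1) = 1 by ring, sub_le_self_iff, ← h.α_zero]
      exact h.α_le le_rfl zero_le_one (by omega)
    | pred j h2 ih =>
      have := ih (by omega)
      rw [a₀_rec _ h1 (by omega), sub_add_cancel]
      have : a₁ (j - 1) ≤ M (j - 1) := le_max_left _ _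
      linarith
  have M_le : ∀ j, 1 ≤ j → j ≤ (k : ℤ) → M j ≤ a₀ j := fun j h1 h2 => by
    rw [a₀_rec j h1 h2]
    linarith [a₁_le (j + 1) (by omega) (by omega)]
  have path : IsVPath 0 (k + 2) 1 (fun j => if j ≤ 0 then 0 else a₀ j)
      (fun j => if j ≤ 0 then 0 else b₀ j) (fun j => if j ≤ 0 then 0 else c₀ j) := by
    refine ⟨?_, ?_, ?_, ?_, ?_, ?_, fun j h1 h2 => ?_, fun j h1 h2 => ?_, fun j h1 h2 => ?_,
      fun j h1 h2 => ?_, fun j h1 h2 => ?_⟩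
    · rw [if_pos le_rfl]
    · rw [if_pos le_rfl]
    · rw [if_pos le_rfl]
    · rw [zero_add, if_neg (by omega), a₀_two]
    · rw [zero_add, if_neg (by omega), b₀_full]
    · rw [zero_add, if_neg (by omega), c₀_full]
    all_goals
      rcases h1.eq_or_lt with rfl | h1
      · rw [if_pos le_rfl, if_neg (by omega), zero_add]
        first
          | exact b₀_one.ge
          | exact c₀_one.ge
          | exact b₀_one.le
          | exact c₀_one.le
          | exact a₁_one.ge.trans (a₁_le 1 le_rfl (by omega))
      rw [if_neg (by omega), if_neg (by omega)]
    · rcases (by omega : j = k + 1 ∨ j ≤ k) with rfl | h3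
      · rw [a₀_one, add_assoc, one_add_one_eq_two, a₀_two]
      · rw [a₀_rec j h1 h3]
        have : M j ≤ a₁ (j + 1) := max_le (a₁_mono j h1 (by omega))
          (max_le (b₀_le _ (by omega) (by omega)) (c₀_le _ (by omega) (by omega)))
        linarith
    · exact b₀_mono j h1 (by omega)
    · exact c₀_mono j h1 (by omega)
    · rcases (by omega : j = k + 1 ∨ j ≤ k) with rfl | h3
      · rw [a₀_one, add_assoc, one_add_one_eq_two, b₀_full]
      · exact ((le_max_left _ _).trans (le_max_right _ _)).trans (M_le j h1 h3)
    · rcases (by omega : j = k + 1 ∨ j ≤ k) with rfl | h3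
      · rw [a₀_one, add_assoc, one_add_one_eq_two, c₀_full]
      · exact ((le_max_right _ _).trans (le_max_right _ _)).trans (M_le j h1 h3)
  obtain ⟨a, b, c, g, E⟩ := path.hasGrowth (by omega)
  have Ea : ∀ j, 1 ≤ j → j ≤ (k : ℤ) + 2 → a 0 j = a₀ j := fun j h1 h2 => by
    rw [(E j (by omega) h2).1]; exact if_neg (by omega)
  have Eb : ∀ j, 1 ≤ j → j ≤ (k : ℤ) + 2 → b 0 j = b₀ j := fun j h1 h2 => by
    rw [(E j (by omega) h2).2.1]; exact if_neg (by omega)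
  have Ec : ∀ j, 1 ≤ j → j ≤ (k : ℤ) + 2 → c 0 j = c₀ j := fun j h1 h2 => by
    rw [(E j (by omega) h2).2.2]; exact if_neg (by omega)
  -- The diagram was obtained from row `0` alone. The rule, read rightwards from the diagonal,
  -- returns the prescribed row `1`.
  have Ea₁ : ∀ j, 1 ≤ j → j ≤ (k : ℤ) + 1 → a 1 j = a₁ j := fun j h1 h2 => by
    induction j, h1 using Int.leInduction with
    | base => rw [g.a_zero, a₁_one]
    | succ j h1 ih =>
      have r := (g.rule 0 j (by omega) (by omega)).rule_a
      rw [zero_add, ih (by omega), Ea j h1 (by omega), Ea (j + 1) (by omega) (by omega),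
        Eb (j + 1) (by omega) (by omega), Ec (j + 1) (by omega) (by omega)] at r
      have := a₀_rec j h1 (by omega)
      linarith
  refine ⟨a, b, c, g, IsLadder.toPolytope_congr _ _ fun x m h1 h2 => ?_⟩
  rcases x with _ | _ | _ <;> dsimp only [VPoset.fiber]
  · rw [zero_add, zero_add, Ea₁ _ (by omega) (by omega)]
    simp [a₁]
  · rw [zero_add, Eb _ (by omega) (by omega)]
    simp [b₀]
  · rw [zero_add, Ec _ (by omega) (by omega)]
    simp [c₀]

end IsLadder

/-! ### The flip and the exact order -/

theorem rowmotion_pow_eq_flip {k : ℕ} {L : VPoset × Fin k ≃ Fin (Nat.card (VPoset × Fin k))}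
    (hL : Monotone L) : OrderPolytope.rowmotion L ^ (k + 2) = orderPolytopeFlip k := by
  refine Equiv.ext fun f => ?_
  obtain ⟨α, β, γ, h, rfl⟩ := IsLadder.exists_toPolytope f
  obtain ⟨a, b, c, g, e⟩ := h.exists_growth
  rw [← e, g.rowmotion_pow_ladder hL, g.flip_ladder, Nat.cast_add, Nat.cast_two]

/-- The edge growth diagram with sites `1` and `2`. -/
theorem exists_edge_growth {q : ℤ} (hq : 3 ≤ q) : ∃ a b c : ℤ → ℤ → ℝ, IsGrowth q 1 a b c ∧
    a 1 2 = 1 ∧ (∀ i, 2 ≤ i → i < q → a i (i + 1) = 0) := by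
  have hq0 : 0 < q := by omega
  let ι : ℤ → ℤ := fun i => siteCount q 1 i + siteCount q 2 i
  have V : ∀ i, (i = 0 → ι i = 0) ∧ (i = 1 → ι i = 1) ∧ (2 ≤ i → i ≤ q → ι i = 2) ∧
      (i = q + 1 → ι i = 3) := fun i => by
    have s1 := siteCount_spec hq0 1 i
    have s2 := siteCount_spec hq0 2 i
    simp only [ι]
    omega
  refine ⟨_, _, _, (IsGrowth.edge_two zero_le_one).pull (ι := ι) hq0 (fun i => ?_) 0 fun i h1 h2 => ?_,
    if_pos ?_, fun i h1 h2 => if_neg ?_⟩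
  · simp only [ι, siteCount_add hq0]; ring
  · have := V i
    have := V (i + 1)
    omega
  · have := V 1
    have := V 2
    omega
  · have := V i
    have := V (i + 1)
    omega

theorem IsGrowth.a_add_mul {q : ℤ} {N : ℝ} {a b c : ℤ → ℤ → ℝ} (h : IsGrowth q N a b c) (i j : ℤ)
    (n : ℕ) : a (i + q * n) (j + q * n) = a i j := by
  induction n with
  | zero => simp
  | succ n ih =>
    rw [← ih, ← h.a_flip (i + q * n)]
    push_cast
    ring_nf

/-- On the orbit of a single edge, the `A`-value at height `k` reads the superdiagonal `a (i + 1) (i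
+ 2)`. Modulo `k + 2` this sequence is `1` at exactly two consecutive places, so its least period is
`k + 2`. -/
theorem dvd_of_rowmotion_pow_eq_one {k : ℕ} (hk : 1 ≤ k)
    {L : VPoset × Fin k ≃ Fin (Nat.card (VPoset × Fin k))} (hL : Monotone L) {d : ℕ}
    (hd : OrderPolytope.rowmotion L ^ d = 1) : k + 2 ∣ d := by
  obtain ⟨a, b, c, g, h1, h0⟩ := exists_edge_growth (q := k + 2) (by omega)
  have top : ∀ i : ℕ, a (i + 1 : ℤ) (i + 1 + 1) = a ((i + d : ℕ) + 1 : ℤ) ((i + d : ℕ) + 1 + 1) := by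
    intro i
    have e : (g.ladder i).toPolytope = (g.ladder (i + d : ℕ)).toPolytope := by
      rw [← g.rowmotion_pow_ladder hL i, ← g.rowmotion_pow_ladder hL (i + d), pow_add, hd, mul_one]
    have e' := congrArg (fun f => f.1 (toHat (VPoset.A, ⟨k - 1, by omega⟩))) e
    simp only [IsLadder.toPolytope_toHat, VPoset.fiber] at e'
    have s : ∀ j : ℤ, j + (k + 2) - (((k - 1 : ℕ) : ℤ) + 1) = j + 1 + 1 := fun j => by omega
    rw [s, s] at e'
    linarith
  have red : ∀ i : ℕ, a ((i + d : ℕ) + 1 : ℤ) ((i + d : ℕ) + 1 + 1) =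
      a ((i + d % (k + 2) : ℕ) + 1 : ℤ) ((i + d % (k + 2) : ℕ) + 1 + 1) := fun i => by
    rw [← g.a_add_mul ((i + d % (k + 2) : ℕ) + 1 : ℤ) _ (d / (k + 2))]
    have e : (d : ℤ) = ((d % (k + 2) : ℕ) : ℤ) + (k + 2) * (d / (k + 2) : ℕ) := by
      exact_mod_cast (Nat.mod_add_div d (k + 2)).symm
    rw [Nat.cast_add, Nat.cast_add]
    congr 1 <;> linarith
  have hlt := Nat.mod_lt d (show 0 < k + 2 by omega)
  rw [Nat.dvd_iff_mod_eq_zero]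
  by_contra hne
  have t0 := (top 0).trans (red 0)
  have t1 := (top 1).trans (red 1)
  generalize d % (k + 2) = r at *
  simp only [zero_add, Nat.cast_zero] at t0
  rw [show (1 : ℤ) + 1 = 2 by norm_num, h1] at t0
  -- A shift by `r < k + 1` moves the entry `a 1 2 = 1` onto a zero. For `r = k + 1` it lands on the
  -- neighbouring `1`, so the next entry, `a 2 3 = 0`, is compared instead; it is moved onto a copy
  -- of `a 1 2`.
  rcases (by omega : r < k + 1 ∨ r = k + 1) with hr | hr
  · rw [h0 _ (by omega) (by omega)] at t0
    exact one_ne_zero t0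
  · rw [Nat.cast_one, h0 (1 + 1) (by omega) (by omega)] at t1
    refine zero_ne_one (t1.trans ?_)
    rw [← h1, ← g.a_flip 1 2, hr]
    congr 1
    push_cast
    ring

theorem orderPolytopeFlip_ne_one {k : ℕ} (hk : 1 ≤ k) : orderPolytopeFlip k ≠ 1 := by
  intro h
  -- The point equal to `1` on the `B`-fiber and `0` on the other two is not symmetric.
  have hl : IsLadder k (fun m => if m ≤ (k : ℤ) then 0 else 1) (fun m => if m ≤ 0 then 0 else 1)
      (fun m => if m ≤ (k : ℤ) then 0 else 1) := by
    refine ⟨?_, ?_, ?_, ?_, ?_, ?_, ?_, ?_, ?_, ?_, ?_⟩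
    all_goals try intro m h1 h2
    all_goals split_ifs <;> first | omega | norm_num
  have e := congrArg (fun σ : Equiv.Perm _ => (σ hl.toPolytope).1 (toHat (VPoset.B, ⟨0, hk⟩))) h
  simp only [IsLadder.flip_toPolytope, Equiv.Perm.one_apply, IsLadder.toPolytope_toHat,
    VPoset.fiber] at e
  rw [if_pos (by simpa using hk), if_neg (by simp)] at e
  exact zero_ne_one e

theorem orderPolytopeFlip_sq (k : ℕ) : orderPolytopeFlip k ^ 2 = 1 := by
  refine Equiv.ext fun f => OrderPolytope.ext_toHat fun p => ?_
  obtain ⟨_ | _ | _, m⟩ := p <;> rfl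

theorem orderOf_rowmotion {k : ℕ} (hk : 1 ≤ k)
    {L : VPoset × Fin k ≃ Fin (Nat.card (VPoset × Fin k))} (hL : Monotone L) :
    orderOf (OrderPolytope.rowmotion L) = 2 * (k + 2) := by
  have h := rowmotion_pow_eq_flip hL
  have h2 : orderOf (OrderPolytope.rowmotion L) ∣ (k + 2) * 2 :=
    orderOf_dvd_of_pow_eq_one (by rw [pow_mul, h, orderPolytopeFlip_sq])
  obtain ⟨e, he⟩ := dvd_of_rowmotion_pow_eq_one hk hL (pow_orderOf_eq_one (OrderPolytope.rowmotion L))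
  rw [he] at h2
  rw [he, mul_comm 2]
  -- The order is `(k + 2) * e` with `e` dividing 2, and `e = 1` would make `Flip` trivial.
  rcases (Nat.dvd_prime Nat.prime_two).1 (Nat.dvd_of_mul_dvd_mul_left (by omega) h2) with rfl | rfl
  · rw [mul_one] at he
    have := pow_orderOf_eq_one (OrderPolytope.rowmotion L)
    rw [he, h] at this
    exact absurd this (orderPolytopeFlip_ne_one hk)
  · rfl

theorem mainTheorem2 :
    (∀ q : ℕ, 3 ≤ q →
      ∀ L : VPoset × Fin (q - 2) ≃ Fin (Nat.card (VPoset × Fin (q - 2))), Monotone L →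
        OrderPolytope.rowmotion L ^ q = orderPolytopeFlip (q - 2)) ∧
    (∀ k : ℕ, 1 ≤ k →
      ∀ L : VPoset × Fin k ≃ Fin (Nat.card (VPoset × Fin k)), Monotone L →
        orderOf (OrderPolytope.rowmotion L) = 2 * (k + 2)) := by
  refine ⟨fun q hq L hL => ?_, fun k hk L hL => orderOf_rowmotion hk hL⟩
  have := rowmotion_pow_eq_flip hL
  rwa [Nat.sub_add_cancel (by omega : 2 ≤ q)] at this
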